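/- For every integer $d\ge 2$ there is a constant $C_G=C_G(d)>0$, depending only on $d$, with the following property. Let $0<\varepsilon<\delta$ with $\delta\ge C_G\,\varepsilon$, and let $R:\delta\mathbb Z^d\to SO(d)$ be any map. Then there are a set $V\subseteq\mathbb R^d$ and a family $E$ of subsets of $\mathbb R^d$ such that: 1. (Triangulation) $(V,E)$ is a triangulation of $\mathbb R^d$: every $e\in E$ has nonempty interior and is the convex hull of a (necessarily unique) set $v_e$ of exactly $d+1$ points; $V=\bigcup_{e\in E}v_e$; $e\cap e'=\operatorname{conv}(v_e\cap v_{e'})$ for all $e,e'\in E$; and $\bigcup_{e\in E}e=\mathbb R^d$. 2. (Delaunay) For every $e\in E$, the unique open ball $B$ with $v_e\subseteq\partial B$ satisfies $B\cap V=\emptyset$. 3. ($C_G$-nondegeneracy) $(\operatorname{diam} e)^d\le C_G\,\mathscr L^d(e)$ for every $e\in E$, where $\mathscr L^d$ is Lebesgue measure. 4. ($(C_G,\varepsilon)$-uniformity) $|x-y|\ge \varepsilon/C_G$ for all $x,y\in V$ with $x\neq y$, and every open ball of radius $C_G\,\varepsilon$ in $\mathbb R^d$ contains a point of $V$. 5.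 (Orientation) For every $z\in\delta\mathbb Z^d$, $$V\cap Q_{\delta-C_G\varepsilon}(z)=\varepsilon R(z)\mathbb Z^d\cap Q_{\delta-C_G\varepsilon}(z),$$ where $Q_\ell(z)=z+(-\ell/2,\ell/2)^d$ is the open cube with centre $z$ and edge length $\ell$ (empty if $\ell\le 0$). -/

import Mathlib

open scoped Pointwise

/-- Euclidean space `ℝ^d`. -/
abbrev Euc (d : ℕ) : Type := EuclideanSpace ℝ (Fin d)

/-- `v` is the vertex set `v_e` of the (nondegenerate, compact) simplex `e ⊆ ℝ^d`: `e` has nonempty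
interior, `v` has exactly `d + 1` elements, and `e = conv v`. Such a `v` is unique, see
`IsVertexSet.unique`. -/
def IsVertexSet {d : ℕ} (v e : Set (Euc d)) : Prop :=
  (interior e).Nonempty ∧ v.ncard = d + 1 ∧ e = convexHull ℝ v

/-- The vertices of a nondegenerate simplex are its extreme points. -/
theorem IsVertexSet.eq_extremePoints {d : ℕ} {v e : Set (Euc d)} (h : IsVertexSet v e) :
    v = e.extremePoints ℝ := by
  obtain ⟨hint, hcard, rfl⟩ := h
  have hfin : v.Finite := Set.finite_of_ncard_ne_zero (by omega)
  have hsub : (convexHull ℝ v).extremePoints ℝ ⊆ v := extremePoints_convexHull_subset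
  have hcl := closure_convexHull_extremePoints (hfin.isCompact_convexHull ℝ) (convex_convexHull ℝ v)
  have hfx : ((convexHull ℝ v).extremePoints ℝ).Finite := hfin.subset hsub
  rw [(hfx.isCompact_convexHull ℝ).isClosed.closure_eq] at hcl
  set x := (convexHull ℝ v).extremePoints ℝ
  rw [← hcl] at hint
  have htop : affineSpan ℝ x = ⊤ := interior_convexHull_nonempty_iff_affineSpan_eq_top.1 hint
  refine (Set.eq_of_subset_of_ncard_le hsub ?_ hfin).symm
  have hne : x.Nonempty := by
    rw [← convexHull_nonempty_iff (𝕜 := ℝ)]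
    exact hint.mono interior_subset
  have hpos : 0 < x.ncard := (Set.ncard_pos hfx).2 hne
  have hv : vectorSpan ℝ x = ⊤ := by
    rw [← direction_affineSpan, htop, AffineSubspace.direction_top]
  haveI : Fintype x := hfx.fintype
  have hle := finrank_vectorSpan_range_le ℝ (fun y : x => (y : Euc d)) (n := x.ncard - 1)
    (by rw [← Nat.card_eq_fintype_card, Nat.card_coe_set_eq]; omega)
  rw [Subtype.range_coe, hv, finrank_top, finrank_euclideanSpace_fin] at hle
  omega

theorem IsVertexSet.unique {d : ℕ} {v w e : Set (Euc d)} (hv : IsVertexSet v e)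
    (hw : IsVertexSet w e) : v = w :=
  hv.eq_extremePoints.trans hw.eq_extremePoints.symm

/-- `(V, E)` is a triangulation of `ℝ^d`: every `e ∈ E` is a nondegenerate simplex with a vertex
set `v_e`, `V` is the union of all the `v_e`, any two elements satisfy
`e ∩ e' = conv (v_e ∩ v_{e'})`, and the elements cover `ℝ^d`. -/
structure IsTriangulation {d : ℕ} (V : Set (Euc d)) (E : Set (Set (Euc d))) : Prop where
  simplex : ∀ e ∈ E, ∃ v, IsVertexSet v e
  vertices : V = {x | ∃ e ∈ E, ∃ v, IsVertexSet v e ∧ x ∈ v}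
  inter : ∀ e ∈ E, ∀ e' ∈ E, ∀ v v', IsVertexSet v e → IsVertexSet v' e' →
    e ∩ e' = convexHull ℝ (v ∩ v')
  cover : ⋃₀ E = Set.univ

/-- The Delaunay property: for each `e ∈ E`, the (unique) open ball whose boundary sphere contains
all vertices of `e` contains no point of `V`. -/
def IsDelaunay {d : ℕ} (V : Set (Euc d)) (E : Set (Set (Euc d))) : Prop :=
  ∀ e ∈ E, ∀ v, IsVertexSet v e →
    ∃ (q : Euc d) (r : ℝ), 0 < r ∧ v ⊆ Metric.sphere q r ∧ Metric.ball q r ∩ V = ∅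

/-- `c`-nondegeneracy: `c > 0` and `(diam e)^d ≤ c * ℒ^d(e)` for all `e ∈ E`. (The elements of a
triangulation are compact, so their diameter and volume are finite.) -/
def IsNondegenerate {d : ℕ} (E : Set (Set (Euc d))) (c : ℝ) : Prop :=
  0 < c ∧ ∀ e ∈ E, Metric.diam e ^ d ≤ c * (MeasureTheory.volume e).toReal

/-- `V` is `(c, ε)`-uniform. -/
def IsUniform {d : ℕ} (V : Set (Euc d)) (c ε : ℝ) : Prop :=
  0 < c ∧ 0 < ε ∧ (∀ x ∈ V, ∀ y ∈ V, x ≠ y → ε / c ≤ dist x y) ∧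
    ∀ q : Euc d, (Metric.ball q (c * ε) ∩ V).Nonempty

/-- The lattice `ℤ^d ⊆ ℝ^d`. -/
def intLattice (d : ℕ) : Set (Euc d) := {x | ∀ i, ∃ n : ℤ, x i = n}

/-- The open cube `Q_l(z) = z + (-l/2, l/2)^d` (empty if `l ≤ 0`, when `d ≥ 1`). -/
def cube {d : ℕ} (l : ℝ) (z : Euc d) : Set (Euc d) :=
  {x | ∀ i, x i - z i ∈ Set.Ioo (-(l / 2)) (l / 2)}

/-!
The proof separates the existence of a Delaunay triangulation from the choice of its vertices.

*Triangulation.* For a locally finite, relatively dense `V`, lift `p ∈ V` to the paraboloid height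
`‖p‖²` plus an infinitesimal belonging to `p` alone. Heights live in the lexicographically ordered
real vector space `Height d`, so the affine maps `a : ℝ^d → Height d` below the height function
play the role of supporting hyperplanes. The infinitesimals break all ties: an affine minorant that
touches the heights at `d + 1` affinely independent points touches them nowhere else
(`mem_of_interpolant_eq_height`), even where many points of `V` are cospherical, as in a lattice.
The contact sets are therefore simplices, two of them meet in a common face
(`convexHull_inter_of_minorants`), and the leading coefficient of a minorant says that the
circumscribed ball is empty. Around a point off the flats spanned by at most `d` points of `V`, a
simplex with the lowest interpolant carries a minorant, since otherwise a pivot would lower the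
interpolant (`IsGeneric.exists_pivot`). The remaining points are reached by density and local
finiteness, which gives `exists_delaunay_triangulation`.

*Vertices.* In units of `ε`, keep the rotated lattice in each cube shrunk by a fixed amount, complete
these points to a relatively dense separated set, and move the added points one after the other, each
to a position at distance at least `η(d)` from a hyperplane through any at most `d` nearby points
that are already placed. Only boundedly many hyperplanes have to be avoided, so this is possible
(`exists_perturbation`). A Delaunay simplex has bounded edges and meets at most one grain. Its lattice
vertices form one of finitely many affinely independent configurations up to isometry, and each added
vertex is far from a hyperplane through the preceding ones. Hence its vertices satisfy a quantitative
form of affine independence, `Thick`, with a constant depending on `d` only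
(`exists_thick_point_set`). A thick simplex contains a ball of comparable size, which bounds its
volume from below. No lower bound on the quality of the faces is needed for the perturbation, because
the distance is measured to hyperplanes and not to the spans themselves.
-/

open scoped Pointwise

namespace Delaunay

/-! ### Affine maps, barycentric coordinates and regular triangulations -/

section Affine

variable {d : ℕ} {M : Type*} [AddCommGroup M] [Module ℝ M]

theorem affineMap_sum_smul {ι : Type*} (a : Euc d →ᵃ[ℝ] M) (s : Finset ι) (w : ι → ℝ)
    (hw : ∑ i ∈ s, w i = 1) (f : ι → Euc d) :
    a (∑ i ∈ s, w i • f i) = ∑ i ∈ s, w i • a (f i) := by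
  have key : ∀ x, a x = a.linear x + a 0 := fun x => congrFun a.decomp x
  have h2 : ∑ i ∈ s, w i • a (f i) = ∑ i ∈ s, w i • a.linear (f i) + (∑ i ∈ s, w i) • a 0 := by
    rw [Finset.sum_smul, ← Finset.sum_add_distrib]
    exact Finset.sum_congr rfl fun i _ => by rw [key (f i), smul_add]
  rw [h2, hw, one_smul, key, map_sum]
  simp

theorem affineSpan_finset_eq_top {S : Finset (Euc d)}
    (hS : AffineIndependent ℝ ((↑) : S → Euc d)) (hc : S.card = d + 1) :
    affineSpan ℝ (S : Set (Euc d)) = ⊤ := by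
  have := hS.affineSpan_eq_top_iff_card_eq_finrank_add_one.2 (by simp [hc])
  simpa using this

theorem exists_barycentric {S : Finset (Euc d)}
    (hS : AffineIndependent ℝ ((↑) : S → Euc d)) (hc : S.card = d + 1) :
    ∃ μ : Euc d → Euc d →ᵃ[ℝ] ℝ, (∀ x, ∑ s ∈ S, μ s x = 1) ∧ (∀ x, ∑ s ∈ S, μ s x • s = x) ∧
      ∀ s ∈ S, ∀ t ∈ S, μ s t = if s = t then 1 else 0 := by
  classical
  let b : AffineBasis S ℝ (Euc d) :=
    ⟨((↑) : S → Euc d), hS, by simpa using affineSpan_finset_eq_top hS hc⟩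
  refine ⟨fun s => if h : s ∈ S then b.coord ⟨s, h⟩ else 0, fun x => ?_, fun x => ?_, ?_⟩
  · rw [← b.sum_coord_apply_eq_one x, ← Finset.sum_coe_sort S]
    simp
  · conv_rhs => rw [← b.linear_combination_coord_eq_self x]
    rw [← Finset.sum_coe_sort S]
    refine Finset.sum_congr rfl fun i _ => ?_
    beta_reduce
    rw [dif_pos i.2]
    rfl
  · intro s hs t ht
    have this : b.coord ⟨s, hs⟩ t = _ := b.coord_apply ⟨s, hs⟩ ⟨t, ht⟩
    beta_reduce
    rw [dif_pos hs]
    simp only [Subtype.mk.injEq] at this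
    exact this

theorem exists_interpolant {S : Finset (Euc d)}
    (hS : AffineIndependent ℝ ((↑) : S → Euc d)) (hc : S.card = d + 1) (h : Euc d → M) :
    ∃ a : Euc d →ᵃ[ℝ] M, ∀ s ∈ S, a s = h s := by
  classical
  obtain ⟨μ, -, -, h3⟩ := exists_barycentric hS hc
  refine ⟨∑ s ∈ S, (LinearMap.toSpanSingleton ℝ M (h s)).toAffineMap.comp (μ s), fun t ht => ?_⟩
  have : ∀ T : Finset (Euc d), (∑ s ∈ T,
      (LinearMap.toSpanSingleton ℝ M (h s)).toAffineMap.comp (μ s)) t = ∑ s ∈ T, μ s t • h s := by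
    intro T
    induction T using Finset.induction_on with
    | empty => simp
    | insert s T hs ih => rw [Finset.sum_insert hs, Finset.sum_insert hs, ← ih]; simp
  rw [this, Finset.sum_congr rfl fun s hs => by rw [h3 s hs t ht]]
  simp [ht]

/-- The weighted sum over a simplex in which the vertex `s₀` has been exchanged for `p`, where `t` is
the weight at which the combination `l - t • μ` loses `s₀`. -/
theorem sum_exchange_smul [DecidableEq (Euc d)] {S : Finset (Euc d)} {p s₀ : Euc d} {t : ℝ}
    {w l μ : Euc d → ℝ} (hp : p ∉ S) (hwp : w p = t) (hw : ∀ s ∈ S, w s = l s - t * μ s)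
    (h0 : l s₀ - t * μ s₀ = 0) (g : Euc d → M) :
    ∑ s ∈ insert p (S.erase s₀), w s • g s =
      t • g p + (∑ s ∈ S, l s • g s - t • ∑ s ∈ S, μ s • g s) := by
  have hpe : p ∉ S.erase s₀ := fun hh => hp (Finset.mem_of_mem_erase hh)
  have h1 : ∑ s ∈ S.erase s₀, w s • g s = ∑ s ∈ S, w s • g s := by
    by_cases hs : s₀ ∈ S
    · exact Finset.sum_erase _ (by rw [hw s₀ hs, h0, zero_smul])
    · rw [Finset.erase_eq_of_notMem hs]
  rw [Finset.sum_insert hpe, hwp, h1, Finset.smul_sum, ← Finset.sum_sub_distrib]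
  congr 1
  refine Finset.sum_congr rfl fun s hs => ?_
  rw [hw s hs, sub_smul, mul_smul]

end Affine

section Order

variable {d : ℕ} {M : Type*} [AddCommGroup M] [LinearOrder M] [IsOrderedAddMonoid M] [Module ℝ M]
  [PosSMulStrictMono ℝ M]

/-- Two simplices whose vertex sets are the contact sets of affine minorants of the same height
function meet in a common face. -/
theorem convexHull_inter_of_minorants {S T : Finset (Euc d)} {h : Euc d → M}
    {a b : Euc d →ᵃ[ℝ] M} (haT : ∀ p ∈ T, a p ≤ h p) (haS : ∀ p ∈ S, a p = h p)
    (hbS : ∀ p ∈ S, b p ≤ h p) (hbT : ∀ p ∈ T, b p = h p)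
    (hST : ∀ p ∈ S, b p = h p → p ∈ T) :
    convexHull ℝ (S : Set (Euc d)) ∩ convexHull ℝ (T : Set (Euc d)) =
      convexHull ℝ ((S : Set (Euc d)) ∩ T) := by
  classical
  refine Set.Subset.antisymm ?_ (Set.subset_inter (convexHull_mono Set.inter_subset_left)
    (convexHull_mono Set.inter_subset_right))
  rintro x ⟨hxS, hxT⟩
  obtain ⟨w, hw0, hw1, hwx⟩ := Finset.mem_convexHull'.1 hxS
  obtain ⟨v, hv0, hv1, hvx⟩ := Finset.mem_convexHull'.1 hxT
  have hab : a x ≤ b x := by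
    rw [← hvx, affineMap_sum_smul a T v hv1, affineMap_sum_smul b T v hv1]
    refine Finset.sum_le_sum fun i hi => ?_
    rw [hbT i hi]
    exact smul_le_smul_of_nonneg_left (haT i hi) (hv0 i hi)
  -- The minorant `b` lies below `a` on `S`, so equality at `x` forces contact wherever `w ≠ 0`.
  have hsupp : ∀ i ∈ S, w i ≠ 0 → i ∈ T := by
    intro i hi hwi
    by_contra hiT
    have hlt : b i < h i := lt_of_le_of_ne (hbS i hi) fun e => hiT (hST i hi e)
    have : b x < a x := by
      rw [← hwx, affineMap_sum_smul a S w hw1, affineMap_sum_smul b S w hw1]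
      refine Finset.sum_lt_sum (fun j hj => ?_) ⟨i, hi, ?_⟩
      · rw [haS j hj]
        exact smul_le_smul_of_nonneg_left (hbS j hj) (hw0 j hj)
      · rw [haS i hi]
        exact smul_lt_smul_of_pos_left hlt (lt_of_le_of_ne (hw0 i hi) hwi.symm)
    exact absurd hab (not_le.2 this)
  rw [← Finset.coe_inter, Finset.mem_convexHull']
  have hz : ∀ i ∈ S, i ∉ S ∩ T → w i = 0 := fun i hi hni => by
    by_contra hne
    exact hni (Finset.mem_inter.2 ⟨hi, hsupp i hi hne⟩)
  refine ⟨w, fun i hi => hw0 i (Finset.mem_inter.1 hi).1, ?_, ?_⟩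
  · rw [← hw1]
    exact Finset.sum_subset Finset.inter_subset_left hz
  · rw [← hwx]
    exact Finset.sum_subset Finset.inter_subset_left fun i hi hni => by rw [hz i hi hni, zero_smul]

/-- A point is generic for `F` if it lies on no flat spanned by at most `d` points of `F`. -/
def IsGeneric (F : Set (Euc d)) (x : Euc d) : Prop :=
  ∀ T : Finset (Euc d), (T : Set (Euc d)) ⊆ F → T.card ≤ d →
    x ∉ affineSpan ℝ (T : Set (Euc d))


/-- Carathéodory's theorem at a generic point yields a full-dimensional simplex. -/
theorem IsGeneric.exists_simplex {F : Set (Euc d)} {x : Euc d} (hx : IsGeneric F x)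
    (hF : x ∈ convexHull ℝ F) :
    ∃ S : Finset (Euc d), (S : Set (Euc d)) ⊆ F ∧ S.card = d + 1 ∧
      AffineIndependent ℝ ((↑) : S → Euc d) ∧ x ∈ convexHull ℝ (S : Set (Euc d)) := by
  rw [convexHull_eq_union] at hF
  simp only [Set.mem_iUnion] at hF
  obtain ⟨S, hSF, hS, hxS⟩ := hF
  refine ⟨S, hSF, ?_, hS, hxS⟩
  have h1 : S.card ≤ d + 1 := by
    have := hS.card_le_finrank_succ
    simp only [Fintype.card_coe] at this
    refine this.trans (Nat.succ_le_succ ((Submodule.finrank_le _).trans ?_))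
    simp
  have h2 : ¬ S.card ≤ d := fun h => hx S hSF h (convexHull_subset_affineSpan _ hxS)
  omega

/-- Pivoting: if the interpolant of `h` on a simplex around a generic point `x` exceeds `h` at a
point `p`, exchanging a vertex for `p` gives a simplex around `x` with a lower interpolant. -/
theorem IsGeneric.exists_pivot {F : Set (Euc d)} {x p : Euc d} (hx : IsGeneric F x)
    {S : Finset (Euc d)} (hSF : (S : Set (Euc d)) ⊆ F) (hc : S.card = d + 1)
    (hS : AffineIndependent ℝ ((↑) : S → Euc d)) (hxS : x ∈ convexHull ℝ (S : Set (Euc d)))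
    (hp : p ∈ F) {h : Euc d → M} {a : Euc d →ᵃ[ℝ] M} (ha : ∀ s ∈ S, a s = h s)
    (hap : h p < a p) :
    ∃ T : Finset (Euc d), (T : Set (Euc d)) ⊆ F ∧ T.card = d + 1 ∧
      AffineIndependent ℝ ((↑) : T → Euc d) ∧ x ∈ convexHull ℝ (T : Set (Euc d)) ∧
      ∀ b : Euc d →ᵃ[ℝ] M, (∀ s ∈ T, b s = h s) → b x < a x := by
  classical
  have hpS : p ∉ S := fun hpS => hap.ne (ha p hpS).symm
  obtain ⟨l, hl0, hl1, hlx⟩ := Finset.mem_convexHull'.1 hxS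
  obtain ⟨μ', m1', m2', -⟩ := exists_barycentric hS hc
  obtain ⟨μ, m1, m2⟩ : ∃ μ : Euc d → ℝ, ∑ s ∈ S, μ s = 1 ∧ ∑ s ∈ S, μ s • s = p :=
    ⟨fun s => μ' s p, m1' p, m2' p⟩
  have hpos : (S.filter fun s => 0 < μ s).Nonempty := by
    by_contra hne
    rw [Finset.not_nonempty_iff_eq_empty, Finset.filter_eq_empty_iff] at hne
    have := Finset.sum_nonpos fun i hi => not_lt.1 (hne (x := i) hi)
    linarith
  obtain ⟨s0, hs0, hmin⟩ := Finset.exists_min_image _ (fun s => l s / μ s) hpos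
  obtain ⟨hs0S, hμ0⟩ := Finset.mem_filter.1 hs0
  have hlt0 : 0 < l s0 := by
    refine lt_of_le_of_ne (hl0 s0 hs0S) fun e => ?_
    refine hx (S.erase s0) ((Finset.coe_subset.2 (Finset.erase_subset _ _)).trans hSF)
      (by rw [Finset.card_erase_of_mem hs0S, hc]; simp) ?_
    refine convexHull_subset_affineSpan _ (Finset.mem_convexHull'.2 ⟨l, fun i hi =>
      hl0 i (Finset.mem_of_mem_erase hi), ?_, ?_⟩)
    · rw [← hl1, ← Finset.sum_erase_add S _ hs0S, ← e, add_zero]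
    · rw [← hlx, ← Finset.sum_erase_add S _ hs0S, ← e, zero_smul, add_zero]
  set t := l s0 / μ s0 with ht
  have htpos : 0 < t := div_pos hlt0 hμ0
  have htμ : l s0 - t * μ s0 = 0 := by rw [ht]; field_simp; ring
  let w : Euc d → ℝ := fun s => if s = p then t else l s - t * μ s
  have hwp : w p = t := if_pos rfl
  have hws : ∀ s ∈ S, w s = l s - t * μ s := fun s hs => if_neg fun e => hpS (by rwa [← e])
  have hw0 : ∀ s ∈ S, 0 ≤ w s := by
    intro s hs
    rw [hws s hs]
    rcases lt_or_ge 0 (μ s) with h0 | h0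
    · have := hmin s (Finset.mem_filter.2 ⟨hs, h0⟩)
      rw [le_div_iff₀ h0] at this
      linarith
    · nlinarith [hl0 s hs]
  have hpe : p ∉ S.erase s0 := fun hh => hpS (Finset.mem_of_mem_erase hh)
  have hT1 : ∑ s ∈ insert p (S.erase s0), w s = 1 := by
    have := sum_exchange_smul hpS hwp hws htμ (fun _ => (1 : ℝ))
    simpa [hl1, m1] using this
  have hTx : ∑ s ∈ insert p (S.erase s0), w s • s = x := by
    rw [sum_exchange_smul hpS hwp hws htμ (fun s => s), m2, hlx]; abel
  have hTF : ((insert p (S.erase s0) : Finset (Euc d)) : Set (Euc d)) ⊆ F := by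
    rw [Finset.coe_insert]
    exact Set.insert_subset hp ((Finset.coe_subset.2 (Finset.erase_subset _ _)).trans hSF)
  have hTc : (insert p (S.erase s0)).card = d + 1 := by
    rw [Finset.card_insert_of_notMem hpe, Finset.card_erase_of_mem hs0S, hc]; simp
  have hTconv : x ∈ convexHull ℝ ((insert p (S.erase s0) : Finset (Euc d)) : Set (Euc d)) := by
    refine Finset.mem_convexHull'.2 ⟨w, fun s hs => ?_, hT1, hTx⟩
    rcases Finset.mem_insert.1 hs with rfl | hs
    · rw [hwp]; exact htpos.le
    · exact hw0 s (Finset.mem_of_mem_erase hs)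
  -- By genericity Carathéodory's theorem cannot discard any vertex of the new simplex.
  obtain ⟨U, hUT, hUc, hU, -⟩ := IsGeneric.exists_simplex
    (F := ((insert p (S.erase s0) : Finset (Euc d)) : Set (Euc d)))
    (fun T hT hTd => hx T (hT.trans hTF) hTd) hTconv
  have hUeq : U = insert p (S.erase s0) :=
    Finset.eq_of_subset_of_card_le (Finset.coe_subset.1 hUT) (by rw [hTc, hUc])
  subst hUeq
  refine ⟨_, hTF, hTc, hU, hTconv, fun b hb => ?_⟩
  have e1 : b x = ∑ s ∈ insert p (S.erase s0), w s • h s := by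
    rw [← hTx, affineMap_sum_smul b _ w hT1]
    exact Finset.sum_congr rfl fun s hs => by rw [hb s hs]
  have e2 : a x = ∑ s ∈ S, l s • h s := by
    rw [← hlx, affineMap_sum_smul a _ l hl1]
    exact Finset.sum_congr rfl fun s hs => by rw [ha s hs]
  have e3 : a p = ∑ s ∈ S, μ s • h s := by
    rw [← m2, affineMap_sum_smul a _ μ m1]
    exact Finset.sum_congr rfl fun s hs => by rw [ha s hs]
  rw [e1, sum_exchange_smul hpS hwp hws htμ, ← e2, ← e3]
  have := smul_lt_smul_of_pos_left hap htpos
  calc t • h p + (a x - t • a p) < t • a p + (a x - t • a p) := by gcongr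
    _ = a x := by abel

/-- Every generic point of the convex hull of a finite set lies in a simplex on which the
height function has an interpolating affine minorant. -/
theorem IsGeneric.exists_minorant {F : Finset (Euc d)} {x : Euc d}
    (hx : IsGeneric (F : Set (Euc d)) x) (hF : x ∈ convexHull ℝ (F : Set (Euc d)))
    (h : Euc d → M) :
    ∃ (S : Finset (Euc d)) (a : Euc d →ᵃ[ℝ] M), S ⊆ F ∧ S.card = d + 1 ∧
      AffineIndependent ℝ ((↑) : S → Euc d) ∧ x ∈ convexHull ℝ (S : Set (Euc d)) ∧
      (∀ s ∈ S, a s = h s) ∧ ∀ p ∈ F, a p ≤ h p := by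
  classical
  have hint : ∀ S : Finset (Euc d), ∃ a : Euc d →ᵃ[ℝ] M,
      AffineIndependent ℝ ((↑) : S → Euc d) → S.card = d + 1 → ∀ s ∈ S, a s = h s := by
    intro S
    by_cases hS : AffineIndependent ℝ ((↑) : S → Euc d) ∧ S.card = d + 1
    · obtain ⟨a, ha⟩ := exists_interpolant hS.1 hS.2 h
      exact ⟨a, fun _ _ => ha⟩
    · exact ⟨0, fun h1 h2 => absurd ⟨h1, h2⟩ hS⟩
  choose a ha using hint
  obtain ⟨S0, h0F, h0c, h0, h0x⟩ := hx.exists_simplex hF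
  obtain ⟨S, hS, hmin⟩ := Finset.exists_min_image
    (F.powerset.filter fun S : Finset (Euc d) => S.card = d + 1 ∧ AffineIndependent ℝ ((↑) : S → Euc d) ∧
      x ∈ convexHull ℝ (S : Set (Euc d))) (fun S : Finset (Euc d) => a S x)
    ⟨S0, Finset.mem_filter.2 ⟨Finset.mem_powerset.2 (Finset.coe_subset.1 h0F), h0c, h0, h0x⟩⟩
  obtain ⟨hSF, hc, hSi, hSx⟩ := Finset.mem_filter.1 hS
  refine ⟨S, a S, Finset.mem_powerset.1 hSF, hc, hSi, hSx, ha S hSi hc, fun p hp => ?_⟩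
  by_contra hlt
  obtain ⟨T, hTF, hTc, hTi, hTx, hT⟩ := hx.exists_pivot
    (Finset.coe_subset.2 (Finset.mem_powerset.1 hSF)) hc hSi hSx
    (Finset.mem_coe.2 hp) (ha S hSi hc) (not_le.1 hlt)
  exact absurd (hmin T (Finset.mem_filter.2 ⟨Finset.mem_powerset.2 (Finset.coe_subset.1 hTF),
    hTc, hTi, hTx⟩)) (not_le.2 (hT (a T) (ha T hTi hTc)))

end Order

/-! ### The infinitesimally perturbed paraboloid -/

section Height

theorem lex_posSMulStrictMono {α : Type*} [LinearOrder α] :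
    PosSMulStrictMono ℝ (Lex (α →₀ ℝ)) where
  smul_lt_smul_of_pos_left c hc a b hab := by
    obtain ⟨i, h1, h2⟩ := Finsupp.Lex.lt_iff.1 hab
    refine Finsupp.Lex.lt_iff.2 ⟨i, fun j hj => ?_, ?_⟩
    · change c * (ofLex a) j = c * (ofLex b) j
      rw [h1 j hj]
    · change c * (ofLex a) i < c * (ofLex b) i
      exact mul_lt_mul_of_pos_left h2 hc

theorem lex_apply_bot_le {α : Type*} [LinearOrder α] {a b : Lex (WithBot α →₀ ℝ)} (h : a ≤ b) :
    (ofLex a) ⊥ ≤ (ofLex b) ⊥ := by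
  rcases h.eq_or_lt with rfl | h
  · exact le_rfl
  · obtain ⟨i, h1, h2⟩ := Finsupp.Lex.lt_iff.1 h
    rcases eq_or_ne i ⊥ with rfl | hi
    · exact h2.le
    · exact (h1 ⊥ (bot_lt_iff_ne_bot.2 hi)).le

/-- Values of height functions: the coefficient at `⊥` dominates, and the coefficients at points
of `ℝ^d` (ordered lexicographically, an arbitrary choice) are successively smaller
infinitesimals. -/
abbrev Height (d : ℕ) : Type := Lex (WithBot (Lex (Fin d → ℝ)) →₀ ℝ)

instance (d : ℕ) : PosSMulStrictMono ℝ (Height d) := lex_posSMulStrictMono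

/-- The point `p` as an element of a linearly ordered index type. -/
def key {d : ℕ} (p : Euc d) : WithBot (Lex (Fin d → ℝ)) := ((toLex fun i => p i : Lex _) : WithBot _)

theorem key_injective {d : ℕ} : Function.Injective (key (d := d)) := by
  intro p q h
  have := toLex.injective (WithBot.coe_injective h)
  ext i
  exact congrFun this i

/-- The height `‖p‖²` of the paraboloid, plus an infinitesimal belonging to `p` alone. -/
noncomputable def height {d : ℕ} (p : Euc d) : Height d :=
  toLex (Finsupp.single ⊥ (‖p‖ ^ 2) + Finsupp.single (key p) 1)

/-- The coefficient of a height at a given index. -/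
noncomputable def coeff {d : ℕ} (i : WithBot (Lex (Fin d → ℝ))) : Height d →ₗ[ℝ] ℝ where
  toFun a := (ofLex a) i
  map_add' _ _ := rfl
  map_smul' _ _ := rfl

theorem coeff_bot_height {d : ℕ} (p : Euc d) : coeff ⊥ (height p) = ‖p‖ ^ 2 := by
  change (Finsupp.single ⊥ (‖p‖ ^ 2) + Finsupp.single (key p) 1 : _ →₀ ℝ) ⊥ = _
  simp [key]

theorem coeff_key_height {d : ℕ} (p q : Euc d) :
    coeff (key q) (height p) = if p = q then 1 else 0 := by
  classical
  change (Finsupp.single ⊥ (‖p‖ ^ 2) + Finsupp.single (key p) 1 : _ →₀ ℝ) (key q) = _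
  have : (⊥ : WithBot (Lex (Fin d → ℝ))) ≠ key q := WithBot.bot_ne_coe
  simp [Finsupp.single_apply, this, key_injective.eq_iff]

/-- The infinitesimals make every interpolant touch the height function at the interpolation
nodes only. -/
theorem mem_of_interpolant_eq_height {d : ℕ} {S : Finset (Euc d)}
    (hS : AffineIndependent ℝ ((↑) : S → Euc d)) (hc : S.card = d + 1)
    {a : Euc d →ᵃ[ℝ] Height d} (ha : ∀ s ∈ S, a s = height s) {p : Euc d}
    (hp : a p = height p) : p ∈ S := by
  by_contra hpS
  obtain ⟨μ, h1, h2, -⟩ := exists_barycentric hS hc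
  have e : a p = ∑ s ∈ S, μ s p • height s := by
    conv_lhs => rw [← h2 p]
    rw [affineMap_sum_smul a S (fun s => μ s p) (h1 p)]
    exact Finset.sum_congr rfl fun s hs => by rw [ha s hs]
  have := congrArg (coeff (key p)) (hp.symm.trans e)
  rw [map_sum, coeff_key_height, if_pos rfl, Finset.sum_eq_zero] at this
  · exact one_ne_zero this
  · intro s hs
    rw [map_smul, coeff_key_height, if_neg fun h : s = p => hpS (h ▸ hs), smul_zero]

end Height

/-! ### Delaunay cells -/

section Cells

variable {d : ℕ}

/-- The vertex sets of the simplices of the triangulation: `d + 1` affinely independent points of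
`V` at which some affine minorant of the height function touches it. -/
def IsCell (V : Set (Euc d)) (S : Finset (Euc d)) : Prop :=
  (S : Set (Euc d)) ⊆ V ∧ S.card = d + 1 ∧ AffineIndependent ℝ ((↑) : S → Euc d) ∧
    ∃ a : Euc d →ᵃ[ℝ] Height d, (∀ s ∈ S, a s = height s) ∧ ∀ p ∈ V, a p ≤ height p

/-- Completing the square: the paraboloid minus an affine function is the power of a point with
respect to a sphere. -/
theorem exists_power_of_affine (a : Euc d →ᵃ[ℝ] Height d) :
    ∃ (q : Euc d) (k : ℝ), ∀ y, ‖y‖ ^ 2 - coeff ⊥ (a y) = dist y q ^ 2 - k := by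
  let f : Euc d →ₗ[ℝ] ℝ := (coeff ⊥).comp a.linear
  let u := (InnerProductSpace.toDual ℝ (Euc d)).symm (LinearMap.toContinuousLinearMap f)
  have hu : ∀ y, inner ℝ u y = f y := fun y => by
    simp [u, InnerProductSpace.toDual_symm_apply]
  refine ⟨(1 / 2 : ℝ) • u, ‖(1 / 2 : ℝ) • u‖ ^ 2 + coeff ⊥ (a 0), fun y => ?_⟩
  have h1 : a y = a.linear y + a 0 := congrFun a.decomp y
  have h2 : coeff ⊥ (a.linear y) = f y := rfl
  rw [dist_eq_norm, norm_sub_sq_real, inner_smul_right, real_inner_comm, hu, h1, map_add, h2]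
  ring

theorem IsCell.inter {V : Set (Euc d)} {S T : Finset (Euc d)} (hS : IsCell V S)
    (hT : IsCell V T) : convexHull ℝ (S : Set (Euc d)) ∩ convexHull ℝ (T : Set (Euc d)) =
      convexHull ℝ ((S : Set (Euc d)) ∩ T) := by
  obtain ⟨hSV, -, -, a, ha, ha'⟩ := hS
  obtain ⟨hTV, hTc, hTi, b, hb, hb'⟩ := hT
  exact convexHull_inter_of_minorants (h := height) (fun p hp => ha' p (hTV hp)) ha
    (fun p hp => hb' p (hSV hp)) hb fun p _ => mem_of_interpolant_eq_height hTi hTc hb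

theorem IsCell.exists_ball (hd : 1 ≤ d) {V : Set (Euc d)} {S : Finset (Euc d)}
    (hS : IsCell V S) : ∃ (q : Euc d) (r : ℝ), 0 < r ∧ (S : Set (Euc d)) ⊆ Metric.sphere q r ∧
      Metric.ball q r ∩ V = ∅ := by
  obtain ⟨hSV, hc, -, a, ha, ha'⟩ := hS
  obtain ⟨q, k, hq⟩ := exists_power_of_affine a
  have hSk : ∀ s ∈ S, dist s q ^ 2 = k := fun s hs => by
    have := hq s
    rw [ha s hs, coeff_bot_height] at this
    linarith
  obtain ⟨s, hs, t, ht, hst⟩ := Finset.one_lt_card.1 (by omega : 1 < S.card)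
  have hk : 0 < k := by
    refine lt_of_le_of_ne (hSk s hs ▸ sq_nonneg _) fun e => hst ?_
    have h1 := hSk s hs
    have h2 := hSk t ht
    rw [← e, sq_eq_zero_iff, dist_eq_zero] at h1 h2
    rw [h1, h2]
  refine ⟨q, √k, Real.sqrt_pos.2 hk, fun s hs => ?_, ?_⟩
  · rw [Metric.mem_sphere, ← hSk s hs, Real.sqrt_sq dist_nonneg]
  · refine Set.eq_empty_iff_forall_notMem.2 fun p hp => ?_
    have h1 : dist p q < √k := hp.1
    have h2 := hq p
    have h3 : coeff ⊥ (a p) ≤ coeff ⊥ (height p) := lex_apply_bot_le (ha' p hp.2)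
    rw [coeff_bot_height] at h3
    have h4 : dist p q ^ 2 < k := (Real.lt_sqrt dist_nonneg).1 h1
    linarith

/-- Nearby points of a relatively dense set surround `x`: a half-space at `x` contains a ball of
radius `r` within distance `2 * r`. -/
theorem mem_convexHull_of_dense {V : Set (Euc d)} {r : ℝ} (hr : 0 < r)
    (hV : ∀ q, (Metric.ball q r ∩ V).Nonempty) (x : Euc d)
    (hfin : (V ∩ Metric.closedBall x (2 * r)).Finite) :
    x ∈ convexHull ℝ (V ∩ Metric.closedBall x (2 * r)) := by
  by_contra hx
  obtain ⟨f, u, hfx, hfu⟩ := geometric_hahn_banach_point_closed (convex_convexHull ℝ _)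
    (hfin.isCompact_convexHull ℝ).isClosed hx
  let w := (InnerProductSpace.toDual ℝ (Euc d)).symm f
  have hw : ∀ y, f y = inner ℝ w y := fun y => by
    simp [w, InnerProductSpace.toDual_symm_apply]
  have hle : ‖(r / ‖w‖) • w‖ ≤ r := by
    rw [norm_smul, norm_div, norm_norm, Real.norm_of_nonneg hr.le]
    rcases eq_or_ne ‖w‖ 0 with h0 | h0
    · rw [h0, mul_zero]; exact hr.le
    · exact (div_mul_cancel₀ r h0).le
  obtain ⟨v, hvq, hvV⟩ := hV (x - (r / ‖w‖) • w)
  rw [mem_ball_iff_norm] at hvq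
  have hvx : v ∈ V ∩ Metric.closedBall x (2 * r) := by
    refine ⟨hvV, ?_⟩
    rw [mem_closedBall_iff_norm]
    calc ‖v - x‖ = ‖(v - (x - (r / ‖w‖) • w)) - (r / ‖w‖) • w‖ := by congr 1; abel
      _ ≤ ‖v - (x - (r / ‖w‖) • w)‖ + ‖(r / ‖w‖) • w‖ := norm_sub_le _ _
      _ ≤ 2 * r := by linarith
  have h1 := hfu v (subset_convexHull ℝ _ hvx)
  have h2 : f v = f x - r * ‖w‖ + inner ℝ w (v - (x - (r / ‖w‖) • w)) := by
    rw [hw, hw, inner_sub_right, inner_sub_right, inner_smul_right, real_inner_self_eq_norm_sq]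
    rcases eq_or_ne ‖w‖ 0 with h0 | h0
    · rw [h0]; ring
    · field_simp; ring
  have h3 := real_inner_le_norm w (v - (x - (r / ‖w‖) • w))
  nlinarith [norm_nonneg w]

/-- Every generic point lies in a cell; the cell has vertices near the point because its
circumscribed ball contains no point of `V`. -/
theorem exists_isCell {V : Set (Euc d)} {r : ℝ} (hr : 0 < r)
    (hV : ∀ q, (Metric.ball q r ∩ V).Nonempty) {x : Euc d}
    (hfin : (V ∩ Metric.closedBall x (2 * r)).Finite) (hx : IsGeneric V x) :
    ∃ S, IsCell V S ∧ (S : Set (Euc d)) ⊆ Metric.closedBall x (2 * r) ∧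
      x ∈ convexHull ℝ (S : Set (Euc d)) := by
  have hconv := mem_convexHull_of_dense hr hV x hfin
  obtain ⟨F, hF⟩ := hfin.exists_finset_coe
  rw [← hF] at hconv
  have hFV : (F : Set (Euc d)) ⊆ V := hF ▸ Set.inter_subset_left
  obtain ⟨S, a, hSF, hc, hS, hxS, ha, ha'⟩ :=
    IsGeneric.exists_minorant (fun T hT => hx T (hT.trans hFV)) hconv height
  have hSF' : (S : Set (Euc d)) ⊆ F := Finset.coe_subset.2 hSF
  refine ⟨S, ⟨hSF'.trans hFV, hc, hS, a, ha, fun p hp => ?_⟩,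
    hSF'.trans (hF ▸ Set.inter_subset_right), hxS⟩
  by_cases hpF : p ∈ F
  · exact ha' p hpF
  obtain ⟨q, k, hq⟩ := exists_power_of_affine a
  have hFk : ∀ y ∈ F, k ≤ dist y q ^ 2 := fun y hy => by
    have h1 := hq y
    have h2 : coeff ⊥ (a y) ≤ coeff ⊥ (height y) := lex_apply_bot_le (ha' y hy)
    rw [coeff_bot_height] at h2
    linarith
  have hSk : ∀ y ∈ S, dist y q ^ 2 = k := fun y hy => by
    have h1 := hq y
    rw [ha y hy, coeff_bot_height] at h1
    linarith
  obtain ⟨s, hs⟩ : S.Nonempty := Finset.card_pos.1 (by omega)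
  have hk : 0 ≤ k := hSk s hs ▸ sq_nonneg _
  set ρ := √k with hρ
  have hρ0 : 0 ≤ ρ := Real.sqrt_nonneg _
  have hxq : dist x q ≤ ρ := by
    have hsub : (S : Set (Euc d)) ⊆ Metric.closedBall q ρ := fun y hy => by
      rw [Metric.mem_closedBall, hρ, ← hSk y hy, Real.sqrt_sq dist_nonneg]
    exact convexHull_min hsub (convex_closedBall q ρ) hxS
  have hFρ : ∀ y ∈ F, ρ ≤ dist y q := fun y hy => by
    rw [hρ]
    exact Real.sqrt_le_iff.2 ⟨dist_nonneg, hFk y hy⟩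
  -- A ball of radius `r` inside both the empty ball and the ball of radius `2r` about `x`.
  have hρr : ρ < r := by
    by_contra hle
    rw [not_lt] at hle
    obtain ⟨q', h1, h2⟩ : ∃ q', dist q' x ≤ r ∧ dist q' q ≤ ρ - r := by
      rcases le_or_gt (dist x q) r with hxr | hxr
      · exact ⟨q, by rwa [dist_comm], by rw [dist_self]; linarith⟩
      · have hpos : 0 < dist x q := hr.trans hxr
        refine ⟨AffineMap.lineMap x q (r / dist x q), ?_, ?_⟩
        · rw [dist_lineMap_left, Real.norm_of_nonneg (by positivity)]
          field_simp
          exact le_rfl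
        · rw [dist_lineMap_right, Real.norm_of_nonneg]
          · have : (1 - r / dist x q) * dist x q = dist x q - r := by field_simp
            linarith
          · rw [sub_nonneg, div_le_one hpos]
            exact hxr.le
    obtain ⟨v, hv, hvV⟩ := hV q'
    rw [Metric.mem_ball] at hv
    have hvF : v ∈ F := by
      rw [← Finset.mem_coe, hF]
      refine ⟨hvV, ?_⟩
      rw [Metric.mem_closedBall]
      linarith [dist_triangle v q' x]
    linarith [hFρ v hvF, dist_triangle v q' q]
  have hpx : 2 * r < dist p x := by
    by_contra hle
    exact hpF (by rw [← Finset.mem_coe, hF]; exact ⟨hp, not_lt.1 hle⟩)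
  have hpq : ρ < dist p q := by
    linarith [dist_triangle p q x, dist_comm x q]
  have hlt : coeff ⊥ (a p) < coeff ⊥ (height p) := by
    have h1 := hq p
    have h2 : k < dist p q ^ 2 := (Real.sqrt_lt' (hρ0.trans_lt hpq)).1 hpq
    rw [coeff_bot_height]
    linarith
  by_contra hcon
  exact absurd (lex_apply_bot_le (not_le.1 hcon).le) (not_le.2 hlt)

/-- Non-generic points lie on countably many proper affine subspaces, which are null sets. -/
theorem dense_isGeneric {V : Set (Euc d)} (hV : V.Countable) :
    Dense {x | IsGeneric V x} := by
  have hT : ({T : Finset (Euc d) | (T : Set (Euc d)) ⊆ V ∧ T.card ≤ d}).Countable :=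
    ((Set.countable_ofPred_finite_subset hV).preimage
      (f := fun T : Finset (Euc d) => (T : Set (Euc d))) Finset.coe_injective).mono
      fun T hT => show (T : Set (Euc d)).Finite ∧ (T : Set (Euc d)) ⊆ V from
        ⟨T.finite_toSet, hT.1⟩
  have hnull : MeasureTheory.volume (⋃ T ∈ {T : Finset (Euc d) | (T : Set (Euc d)) ⊆ V ∧
      T.card ≤ d}, (affineSpan ℝ (T : Set (Euc d)) : Set (Euc d))) = 0 := by
    rw [MeasureTheory.measure_biUnion_null_iff hT]
    intro T hT
    refine MeasureTheory.Measure.addHaar_affineSubspace _ _ fun htop => ?_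
    have hdir : vectorSpan ℝ (T : Set (Euc d)) = ⊤ := by
      rw [← direction_affineSpan, htop, AffineSubspace.direction_top]
    have hne : (T : Set (Euc d)).Nonempty := by
      rw [← affineSpan_nonempty (k := ℝ), htop]
      exact Set.univ_nonempty
    have hpos : 0 < T.card := Finset.card_pos.2 hne
    have hle := finrank_vectorSpan_range_le ℝ (fun y : T => (y : Euc d)) (n := T.card - 1)
      (by rw [Fintype.card_coe]; omega)
    have hr : Set.range (fun y : T => (y : Euc d)) = T := Subtype.range_coe
    rw [hr, hdir, finrank_top, finrank_euclideanSpace_fin] at hle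
    have := hT.2
    omega
  have hd' : Dense ((⋃ T ∈ {T : Finset (Euc d) | (T : Set (Euc d)) ⊆ V ∧ T.card ≤ d},
      (affineSpan ℝ (T : Set (Euc d)) : Set (Euc d)))ᶜ) := by
    rw [← interior_eq_empty_iff_dense_compl]
    exact MeasureTheory.Measure.interior_eq_empty_of_null hnull
  refine hd'.mono ?_
  intro x hx T hTV hTc hxT
  exact hx (Set.mem_biUnion (x := T) ⟨hTV, hTc⟩ hxT)

theorem IsCell.isVertexSet {V : Set (Euc d)} {S : Finset (Euc d)} (hS : IsCell V S) :
    IsVertexSet (S : Set (Euc d)) (convexHull ℝ (S : Set (Euc d))) :=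
  ⟨interior_convexHull_nonempty_iff_affineSpan_eq_top.2 (affineSpan_finset_eq_top hS.2.2.1 hS.2.1),
    by rw [Set.ncard_coe_finset, hS.2.1], rfl⟩

/-- Cells cover space: near `x` only finitely many cells occur, so their union is closed, and it
contains the nearby generic points. -/
theorem exists_isCell_mem {V : Set (Euc d)} {r : ℝ} (hr : 0 < r)
    (hV : ∀ q, (Metric.ball q r ∩ V).Nonempty) (hcount : V.Countable)
    (hfin : ∀ x R, (V ∩ Metric.closedBall x R).Finite) (x : Euc d) :
    ∃ S, IsCell V S ∧ x ∈ convexHull ℝ (S : Set (Euc d)) := by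
  set 𝒮 := {S : Finset (Euc d) | IsCell V S ∧
    (S : Set (Euc d)) ⊆ V ∩ Metric.closedBall x (2 * r + 1)}
  have h𝒮 : 𝒮.Finite := by
    obtain ⟨F, hF⟩ := (hfin x (2 * r + 1)).exists_finset_coe
    refine (F.powerset.finite_toSet).subset fun S hS => ?_
    rw [Finset.mem_coe, Finset.mem_powerset, ← Finset.coe_subset, hF]
    exact hS.2
  have hclosed : IsClosed (⋃ S ∈ 𝒮, convexHull ℝ (S : Set (Euc d))) :=
    h𝒮.isClosed_biUnion fun S _ => (S.finite_toSet.isCompact_convexHull ℝ).isClosed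
  have hx : x ∈ closure (⋃ S ∈ 𝒮, convexHull ℝ (S : Set (Euc d))) := by
    refine Metric.mem_closure_iff.2 fun η hη => ?_
    obtain ⟨y, hy, hyx⟩ := (dense_isGeneric hcount).exists_dist_lt x (lt_min hη one_pos)
    obtain ⟨S, hS, hSy, hyS⟩ := exists_isCell hr hV (hfin y _) hy
    refine ⟨y, Set.mem_biUnion (x := S) ⟨hS, fun s hs => ⟨hS.1 hs, ?_⟩⟩ hyS,
      hyx.trans_le (min_le_left _ _)⟩
    have h1 : dist s y ≤ 2 * r := hSy hs
    have h2 := hyx.trans_le (min_le_right _ _)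
    rw [Metric.mem_closedBall]
    linarith [dist_triangle s y x, dist_comm x y]
  rw [hclosed.closure_eq] at hx
  simp only [Set.mem_iUnion] at hx
  obtain ⟨S, hS, hxS⟩ := hx
  exact ⟨S, hS.1, hxS⟩

/-- The only points of `V` in a cell are its vertices. By strict convexity of `‖·‖²` the minorant would
exceed the paraboloid at any other point of the cell. -/
theorem IsCell.mem_of_mem_convexHull {V : Set (Euc d)} {S : Finset (Euc d)} (hS : IsCell V S)
    {v : Euc d} (hv : v ∈ V) (hvS : v ∈ convexHull ℝ (S : Set (Euc d))) : v ∈ S := by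
  obtain ⟨hSV, hc, hi, a, ha, ha'⟩ := hS
  obtain ⟨w, hw0, hw1, hwv⟩ := Finset.mem_convexHull'.1 hvS
  have h1 : ∑ s ∈ S, w s * ‖s‖ ^ 2 ≤ ‖v‖ ^ 2 := by
    have h2 : coeff ⊥ (a v) ≤ coeff ⊥ (height v) := lex_apply_bot_le (ha' v hv)
    rw [coeff_bot_height] at h2
    refine le_trans (le_of_eq ?_) h2
    conv_rhs => rw [← hwv]
    rw [affineMap_sum_smul a S w hw1, map_sum]
    exact Finset.sum_congr rfl fun s hs => by rw [map_smul, ha s hs, coeff_bot_height]; rfl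
  have h2 : ∑ s ∈ S, w s * ‖s - v‖ ^ 2 = ∑ s ∈ S, w s * ‖s‖ ^ 2 - ‖v‖ ^ 2 := by
    have e : ∑ s ∈ S, w s * inner ℝ s v = ‖v‖ ^ 2 := by
      rw [← real_inner_self_eq_norm_sq]
      conv_rhs => lhs; rw [← hwv]
      rw [sum_inner]
      exact Finset.sum_congr rfl fun s _ => by rw [real_inner_smul_left]
    have : ∀ s, w s * ‖s - v‖ ^ 2 = w s * ‖s‖ ^ 2 - 2 * (w s * inner ℝ s v) + w s * ‖v‖ ^ 2 :=
      fun s => by rw [norm_sub_sq_real]; ring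
    rw [Finset.sum_congr rfl fun s _ => this s, Finset.sum_add_distrib, Finset.sum_sub_distrib,
      ← Finset.mul_sum, e, ← Finset.sum_mul, hw1]
    ring
  have h3 : ∑ s ∈ S, w s * ‖s - v‖ ^ 2 = 0 :=
    le_antisymm (by linarith) (Finset.sum_nonneg fun s hs => mul_nonneg (hw0 s hs) (sq_nonneg _))
  rw [Finset.sum_eq_zero_iff_of_nonneg fun s hs => mul_nonneg (hw0 s hs) (sq_nonneg _)] at h3
  obtain ⟨s, hs, hws⟩ : ∃ s ∈ S, w s ≠ 0 := Finset.exists_ne_zero_of_sum_ne_zero (by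
    rw [hw1]; exact one_ne_zero)
  have := h3 s hs
  rw [mul_eq_zero, or_iff_right hws, sq_eq_zero_iff, norm_eq_zero, sub_eq_zero] at this
  exact this ▸ hs

/-- A locally finite relatively dense set is the vertex set of a Delaunay triangulation. -/
theorem exists_delaunay_triangulation (hd : 1 ≤ d) {V : Set (Euc d)} {r : ℝ} (hr : 0 < r)
    (hV : ∀ q, (Metric.ball q r ∩ V).Nonempty) (hcount : V.Countable)
    (hfin : ∀ x R, (V ∩ Metric.closedBall x R).Finite) :
    ∃ E : Set (Set (Euc d)), IsTriangulation V E ∧ IsDelaunay V E ∧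
      ∀ e ∈ E, ∃ S : Finset (Euc d), e = convexHull ℝ (S : Set (Euc d)) ∧
        (S : Set (Euc d)) ⊆ V ∧ S.card = d + 1 ∧ AffineIndependent ℝ ((↑) : S → Euc d) ∧
        ∀ x ∈ S, ∀ y ∈ S, dist x y ≤ 2 * r := by
  have hcov := exists_isCell_mem hr hV hcount hfin
  refine ⟨{e | ∃ S, IsCell V S ∧ e = convexHull ℝ (S : Set (Euc d))}, ⟨?_, ?_, ?_, ?_⟩, ?_, ?_⟩
  · rintro _ ⟨S, hS, rfl⟩
    exact ⟨S, hS.isVertexSet⟩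
  · ext x
    constructor
    · intro hx
      obtain ⟨S, hS, hxS⟩ := hcov x
      exact ⟨_, ⟨S, hS, rfl⟩, S, hS.isVertexSet, hS.mem_of_mem_convexHull hx hxS⟩
    · rintro ⟨_, ⟨S, hS, rfl⟩, v, hv, hxv⟩
      rw [hv.unique hS.isVertexSet] at hxv
      exact hS.1 hxv
  · rintro _ ⟨S, hS, rfl⟩ _ ⟨T, hT, rfl⟩ v v' hv hv'
    rw [hv.unique hS.isVertexSet, hv'.unique hT.isVertexSet]
    exact hS.inter hT
  · refine Set.eq_univ_of_forall fun x => ?_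
    obtain ⟨S, hS, hxS⟩ := hcov x
    exact ⟨_, ⟨S, hS, rfl⟩, hxS⟩
  · rintro _ ⟨S, hS, rfl⟩ v hv
    rw [hv.unique hS.isVertexSet]
    exact hS.exists_ball hd
  · rintro _ ⟨S, hS, rfl⟩
    refine ⟨S, rfl, hS.1, hS.2.1, hS.2.2.1, fun x hx y hy => ?_⟩
    obtain ⟨q, ρ, -, hSq, hqV⟩ := hS.exists_ball hd
    obtain ⟨v, hvq, hvV⟩ := hV q
    have hρ : ρ ≤ dist v q := by
      by_contra hlt
      exact (hqV.subset ⟨not_le.1 hlt, hvV⟩ : v ∈ (∅ : Set (Euc d)))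
    have h1 : dist x q = ρ := hSq hx
    have h2 : dist y q = ρ := hSq hy
    have h3 : dist v q < r := hvq
    linarith [dist_triangle_right x y q]

end Cells

/-! ### Quantitative affine independence -/

section Thick

variable {d : ℕ}

/-- Quantitative affine independence of `S`: the weights of an affine combination are controlled
by the vector it represents, with constant `c`. -/
def Thick (c : ℝ) (S : Finset (Euc d)) : Prop :=
  ∀ w : Euc d → ℝ, ∑ x ∈ S, w x = 0 → ∀ x ∈ S, c * |w x| ≤ ‖∑ x ∈ S, w x • x‖

theorem Thick.mono {c c' : ℝ} {S : Finset (Euc d)} (h : Thick c S) (hc : c' ≤ c) : Thick c' S :=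
  fun w hw x hx => (mul_le_mul_of_nonneg_right hc (abs_nonneg _)).trans (h w hw x hx)

/-- Adding a point at distance at least `η` from a hyperplane through the other points. -/
theorem Thick.insert {c η K t : ℝ} {S : Finset (Euc d)} [DecidableEq (Euc d)] (hS : Thick c S)
    (hc : 0 < c) (hη : 0 < η) (hK : 0 ≤ K) {p u : Euc d} (hp : p ∉ S)
    (hpK : ∀ x ∈ S, dist p x ≤ K) (hu : ‖u‖ = 1) (hut : ∀ x ∈ S, inner ℝ u x = t)
    (hpη : η ≤ |inner ℝ u p - t|) : Thick (c * η / (η + K + c)) (insert p S) := by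
  intro w hw x hx
  have hD : 0 < η + K + c := by linarith
  rw [Finset.sum_insert hp] at hw
  rw [Finset.sum_insert hp]
  set y := w p • p + ∑ x ∈ S, w x • x with hy
  have h1 : η * |w p| ≤ ‖y‖ := by
    have e : inner ℝ u y = w p * (inner ℝ u p - t) := by
      rw [hy, inner_add_right, inner_sum, real_inner_smul_right,
        Finset.sum_congr rfl fun x hx => by rw [real_inner_smul_right, hut x hx],
        ← Finset.sum_mul, show ∑ x ∈ S, w x = -w p by linarith]
      ring
    calc η * |w p| ≤ |inner ℝ u p - t| * |w p| := by gcongr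
      _ = |inner ℝ u y| := by rw [e, abs_mul, mul_comm]
      _ ≤ ‖u‖ * ‖y‖ := abs_real_inner_le_norm u y
      _ = ‖y‖ := by rw [hu, one_mul]
  rw [div_mul_eq_mul_div, div_le_iff₀ hD]
  rcases Finset.mem_insert.1 hx with rfl | hxS
  · nlinarith [norm_nonneg y, abs_nonneg (w x)]
  -- Move the weight of `p` to `x`.
  have hsum : ∀ z ∈ S, (w z + if z = x then w p else 0) • z
      = w z • z + if z = x then w p • x else 0 := fun z _ => by
    split_ifs with h
    · rw [add_smul, h]
    · rw [add_zero, add_zero]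
  have h2 := hS (fun z => w z + if z = x then w p else 0)
    (by rw [Finset.sum_add_distrib, Finset.sum_ite_eq' S x, if_pos hxS]; linarith) x hxS
  rw [Finset.sum_congr rfl hsum, Finset.sum_add_distrib, Finset.sum_ite_eq' S x, if_pos hxS,
    if_pos rfl, show ∑ x ∈ S, w x • x + w p • x = y - w p • (p - x) by
      rw [hy, smul_sub]; abel] at h2
  have h3 : ‖y - w p • (p - x)‖ ≤ ‖y‖ + |w p| * K := by
    refine (norm_sub_le _ _).trans ?_
    rw [norm_smul, Real.norm_eq_abs, ← dist_eq_norm p x]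
    have := hpK x hxS
    gcongr
  have h4 : |w x| ≤ |w x + w p| + |w p| := by
    calc |w x| = |(w x + w p) - w p| := by congr 1; ring
      _ ≤ _ := abs_sub _ _
  have h5 : c * |w x| ≤ ‖y‖ + (K + c) * |w p| := by nlinarith
  have h6 : (K + c) * (η * |w p|) ≤ (K + c) * ‖y‖ := by gcongr
  nlinarith

/-- An affinely independent set is thick: the weights of sum zero embed linearly, and an injective
linear map on a finite-dimensional space is bounded below. -/
theorem exists_thick {S : Finset (Euc d)} (hS : AffineIndependent ℝ ((↑) : S → Euc d)) :
    ∃ c, 0 < c ∧ Thick c S := by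
  classical
  let W : Submodule ℝ (S → ℝ) := LinearMap.ker (∑ i : S, LinearMap.proj (R := ℝ) i)
  let f : W →ₗ[ℝ] Euc d :=
    (∑ i : S, (LinearMap.proj (R := ℝ) (φ := fun _ : S => ℝ) i).smulRight (i : Euc d)).comp
      W.subtype
  have hf : ∀ w : W, f w = ∑ i : S, (w : S → ℝ) i • (i : Euc d) := fun w => by
    simp [f]
  have hW : ∀ w : S → ℝ, w ∈ W ↔ ∑ i, w i = 0 := fun w => by simp [W]
  have hker : LinearMap.ker f = ⊥ := by
    rw [LinearMap.ker_eq_bot']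
    intro w hw
    ext i
    refine affineIndependent_iff.1 hS Finset.univ w ((hW w).1 w.2) ?_ i (Finset.mem_univ _)
    rw [← hf, hw]
  obtain ⟨K, hK, hfK⟩ := f.exists_antilipschitzWith hker
  refine ⟨(K : ℝ)⁻¹, by positivity, fun w hw x hx => ?_⟩
  have hmem : (fun i : S => w i) ∈ W := (hW _).2 (by rw [Finset.sum_coe_sort S w, hw])
  have h1 := hfK.le_mul_dist ⟨_, hmem⟩ 0
  rw [map_zero, dist_zero_right, dist_zero_right, hf, Finset.sum_coe_sort S fun x => w x • x] at h1
  have h2 : |w x| ≤ ‖(⟨_, hmem⟩ : W)‖ := norm_le_pi_norm (fun i : S => w i) ⟨x, hx⟩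
  rw [inv_mul_le_iff₀ (by exact_mod_cast hK)]
  exact h2.trans h1

theorem Thick.image_affineIsometry {c : ℝ} {S T : Finset (Euc d)} (φ : Euc d →ᵃⁱ[ℝ] Euc d)
    (hS : Thick c S) (hT : (T : Set (Euc d)) = φ '' S) : Thick c T := by
  classical
  have hTS : T = S.image φ := by
    rw [← Finset.coe_inj, hT, Finset.coe_image]
  subst hTS
  intro w hw x hx
  rw [Finset.sum_image φ.injective.injOn] at hw ⊢
  obtain ⟨y, hy, rfl⟩ := Finset.mem_image.1 hx
  have h1 := hS (fun z => w (φ z)) hw y hy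
  have h2 : ∑ z ∈ S, w (φ z) • φ z = φ.linearIsometry (∑ z ∈ S, w (φ z) • z) := by
    have : ∀ z, φ z = φ.linearIsometry z + φ 0 := fun z => by
      have := φ.map_vadd 0 z
      simpa using this
    have e : ∑ z ∈ S, w (φ z) • φ z =
        ∑ z ∈ S, w (φ z) • φ.linearIsometry z + (∑ z ∈ S, w (φ z)) • φ 0 := by
      rw [Finset.sum_smul, ← Finset.sum_add_distrib]
      exact Finset.sum_congr rfl fun z _ => by rw [← smul_add, ← this z]
    rw [e, hw, zero_smul, add_zero, map_sum]
    exact Finset.sum_congr rfl fun z _ => (map_smul _ _ _).symm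
  rw [h2, LinearIsometry.norm_map]
  exact h1

theorem Thick.smul {c ε : ℝ} {S T : Finset (Euc d)} (hε : 0 < ε) (hS : Thick c S)
    (hT : (T : Set (Euc d)) = ε • (S : Set (Euc d))) : Thick (ε * c) T := by
  classical
  have hTS : T = S.image (ε • ·) := by
    rw [← Finset.coe_inj, hT, Finset.coe_image]; rfl
  subst hTS
  intro w hw x hx
  have hinj : Set.InjOn (fun x : Euc d => ε • x) S := (smul_right_injective _ hε.ne').injOn
  rw [Finset.sum_image hinj] at hw ⊢
  obtain ⟨y, hy, rfl⟩ := Finset.mem_image.1 hx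
  have h1 := hS (fun z => w (ε • z)) hw y hy
  rw [Finset.sum_congr rfl fun z _ => smul_comm (w (ε • z)) ε z, ← Finset.smul_sum, norm_smul,
    Real.norm_of_nonneg hε.le, mul_assoc]
  exact mul_le_mul_of_nonneg_left h1 hε.le

/-- A thick simplex contains a ball about its centroid. -/
theorem Thick.exists_closedBall_subset {c : ℝ} {S : Finset (Euc d)} (hc0 : 0 < c)
    (hS : Thick c S) (hi : AffineIndependent ℝ ((↑) : S → Euc d)) (hc : S.card = d + 1) :
    ∃ x, Metric.closedBall x (c / (d + 1)) ⊆ convexHull ℝ (S : Set (Euc d)) := by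
  obtain ⟨μ, h1, h2, -⟩ := exists_barycentric hi hc
  have hd : (0 : ℝ) < d + 1 := by positivity
  refine ⟨∑ s ∈ S, (1 / (d + 1) : ℝ) • s, fun y hy => ?_⟩
  rw [mem_closedBall_iff_norm] at hy
  refine Finset.mem_convexHull'.2 ⟨fun s => μ s y, fun s hs => ?_, h1 y, h2 y⟩
  have h3 := hS (fun s => μ s y - 1 / (d + 1)) (by
    rw [Finset.sum_sub_distrib, h1, Finset.sum_const, hc, nsmul_eq_mul]
    push_cast
    field_simp
    ring) s hs
  have h4 : ∑ s ∈ S, (μ s y - 1 / (d + 1)) • s = y - ∑ s ∈ S, (1 / (d + 1) : ℝ) • s := by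
    rw [Finset.sum_congr rfl fun s _ => sub_smul _ _ s, Finset.sum_sub_distrib, h2]
  rw [h4] at h3
  have h5 : c * |μ s y - 1 / (d + 1)| ≤ c * (1 / (d + 1)) := (h3.trans hy).trans (by
    rw [mul_one_div])
  have h6 := neg_abs_le (μ s y - 1 / (d + 1))
  have h7 := le_of_mul_le_mul_left h5 hc0
  linarith

/-- Thickness of all members of a family of finite sets which are obtained from members with a
given thickness by successively adding points away from a hyperplane through the others. -/
theorem exists_thick_of_steps {c₀ η K : ℝ} (hc₀ : 0 < c₀) (hη : 0 < η) (hK : 0 ≤ K) (n : ℕ) :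
    ∃ c, 0 < c ∧ ∀ 𝒮 : Set (Finset (Euc d)), (∀ S ∈ 𝒮, Thick c₀ S ∨
      ∃ p u : Euc d, ∃ T ∈ 𝒮, ∃ t : ℝ, p ∉ T ∧ (S : Set (Euc d)) = Insert.insert p ↑T ∧
        (∀ x ∈ T, dist p x ≤ K) ∧ ‖u‖ = 1 ∧ (∀ x ∈ T, inner ℝ u x = t) ∧
        η ≤ |inner ℝ u p - t|) → ∀ S ∈ 𝒮, S.card ≤ n → Thick c S := by
  classical
  induction n with
  | zero =>
    refine ⟨1, one_pos, fun 𝒮 _ S _ hS w _ x hx => ?_⟩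
    rw [Finset.card_eq_zero.1 (Nat.le_zero.1 hS)] at hx
    exact absurd hx (Finset.notMem_empty x)
  | succ n ih =>
    obtain ⟨c, hc, h⟩ := ih
    refine ⟨min c₀ (c * η / (η + K + c)), lt_min hc₀ (by positivity), fun 𝒮 h𝒮 S hS hn => ?_⟩
    rcases h𝒮 S hS with h0 | ⟨p, u, T, hT, t, hpT, hST, hTK, hu, hut, hpη⟩
    · exact h0.mono (min_le_left _ _)
    · have e : S = Insert.insert p T := by
        rw [← Finset.coe_inj, hST, Finset.coe_insert]
      have hTn : T.card ≤ n := by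
        rw [e, Finset.card_insert_of_notMem hpT] at hn
        omega
      rw [e]
      exact ((h 𝒮 h𝒮 T hT hTn).insert hc hη hK hpT hTK hu hut hpη).mono (min_le_right _ _)

end Thick

/-! ### Separated sets -/

section Packing

variable {d : ℕ}

/-- A `σ`-separated set has boundedly many points in a ball of radius `r`, uniformly in the set and
the centre. -/
theorem exists_packing_bound (d : ℕ) {σ : ℝ} (hσ : 0 < σ) (r : ℝ) :
    ∃ N : ℕ, ∀ A : Set (Euc d), (∀ x ∈ A, ∀ y ∈ A, x ≠ y → σ ≤ dist x y) → ∀ q,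
      (A ∩ Metric.closedBall q r).Finite ∧ (A ∩ Metric.closedBall q r).ncard ≤ N := by
  obtain ⟨t, ht, htc⟩ := Metric.totallyBounded_iff.1
    (isCompact_closedBall (0 : Euc d) r).totallyBounded (σ / 2) (by positivity)
  refine ⟨t.ncard, fun A hA q => ?_⟩
  have hc : ∀ x : Euc d, ∃ y, x ∈ A ∩ Metric.closedBall q r → y ∈ t ∧ dist (x - q) y < σ / 2 := by
    intro x
    by_cases hx : x ∈ A ∩ Metric.closedBall q r
    · have : x - q ∈ Metric.closedBall (0 : Euc d) r := by
        rw [mem_closedBall_zero_iff, ← dist_eq_norm]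
        exact hx.2
      obtain ⟨y, hy, hxy⟩ := Set.mem_iUnion₂.1 (htc this)
      exact ⟨y, fun _ => ⟨hy, hxy⟩⟩
    · exact ⟨0, fun h => absurd h hx⟩
  choose g hg using hc
  have hinj : Set.InjOn g (A ∩ Metric.closedBall q r) := by
    intro x hx y hy hxy
    by_contra hne
    have h1 := (hg x hx).2
    have h2 := (hg y hy).2
    rw [← hxy] at h2
    have h3 : dist x y = dist (x - q) (y - q) := by simp
    have h4 := hA x hx.1 y hy.1 hne
    linarith [dist_triangle_right (x - q) (y - q) (g x)]
  have hmaps : ∀ x ∈ A ∩ Metric.closedBall q r, g x ∈ t := fun x hx => (hg x hx).1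
  exact ⟨Set.Finite.of_injOn hmaps hinj ht, Set.ncard_le_ncard_of_injOn g hmaps hinj ht⟩

theorem countable_of_separated {σ : ℝ} (hσ : 0 < σ) {A : Set (Euc d)}
    (hA : ∀ x ∈ A, ∀ y ∈ A, x ≠ y → σ ≤ dist x y) : A.Countable := by
  have : A = ⋃ n : ℕ, A ∩ Metric.closedBall 0 n := by
    ext x
    refine ⟨fun hx => ?_, fun hx => ?_⟩
    · obtain ⟨n, hn⟩ := exists_nat_ge (dist x 0)
      exact Set.mem_iUnion.2 ⟨n, hx, hn⟩
    · obtain ⟨n, hn⟩ := Set.mem_iUnion.1 hx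
      exact hn.1
  rw [this]
  refine Set.countable_iUnion fun n => ?_
  obtain ⟨N, hN⟩ := exists_packing_bound d hσ n
  exact (hN A hA 0).1.countable

/-- A maximal `s`-separated set of points at distance at least `s` from `L` is, together with `L`,
relatively dense. -/
theorem exists_maximal_separated {s : ℝ} (L : Set (Euc d)) (hs : 0 < s) :
    ∃ P : Set (Euc d), (∀ x ∈ P, ∀ y ∈ P, x ≠ y → s ≤ dist x y) ∧
      (∀ x ∈ P, ∀ y ∈ L, s ≤ dist x y) ∧ ∀ q, ∃ y ∈ L ∪ P, dist y q < s := by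
  obtain ⟨P, hP⟩ := zorn_subset {P : Set (Euc d) | (∀ x ∈ P, ∀ y ∈ P, x ≠ y → s ≤ dist x y) ∧
      ∀ x ∈ P, ∀ y ∈ L, s ≤ dist x y} (fun c hc hchain => by
    refine ⟨⋃₀ c, ⟨?_, ?_⟩, fun t ht => Set.subset_sUnion_of_mem ht⟩
    · rintro x ⟨t, ht, hx⟩ y ⟨t', ht', hy⟩ hxy
      rcases hchain.total ht ht' with h | h
      · exact (hc ht').1 x (h hx) y hy hxy
      · exact (hc ht).1 x hx y (h hy) hxy
    · rintro x ⟨t, ht, hx⟩ y hy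
      exact (hc ht).2 x hx y hy)
  refine ⟨P, hP.prop.1, hP.prop.2, fun q => ?_⟩
  by_contra! hq
  have hmem : Insert.insert q P ∈ {P : Set (Euc d) | (∀ x ∈ P, ∀ y ∈ P, x ≠ y → s ≤ dist x y) ∧
      ∀ x ∈ P, ∀ y ∈ L, s ≤ dist x y} := by
    refine ⟨?_, ?_⟩
    · rintro x (rfl | hx) y (rfl | hy) hxy
      · exact absurd rfl hxy
      · rw [dist_comm]; exact hq y (Or.inr hy)
      · exact hq x (Or.inr hx)
      · exact hP.prop.1 x hx y hy hxy
    · rintro x (rfl | hx) y hy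
      · rw [dist_comm]; exact hq y (Or.inl hy)
      · exact hP.prop.2 x hx y hy
  have hqP : q ∈ P := hP.le_of_ge hmem (Set.subset_insert _ _) (Set.mem_insert _ _)
  have := hq q (Or.inr hqP)
  rw [dist_self] at this
  linarith

end Packing

/-! ### Perturbation away from hyperplanes -/

section Perturb

variable {d : ℕ}

/-- A ball contains a smaller ball avoiding finitely many hyperplanes: move away from each of
them in turn by half of the current radius. -/
theorem exists_avoiding_hyperplanes {ι : Type*} (s : Finset ι) (u : ι → Euc d) (t : ι → ℝ)
    (hu : ∀ i ∈ s, ‖u i‖ = 1) (p : Euc d) {ρ : ℝ} (hρ : 0 < ρ) :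
    ∃ q, dist q p + ρ / 4 ^ s.card ≤ ρ ∧ ∀ i ∈ s, ρ / 4 ^ s.card ≤ |inner ℝ (u i) q - t i| := by
  classical
  induction s using Finset.induction_on with
  | empty => exact ⟨p, by simp, by simp⟩
  | insert i s hi ih =>
    obtain ⟨q, hq, hqs⟩ := ih fun j hj => hu j (Finset.mem_insert_of_mem hj)
    rw [Finset.card_insert_of_notMem hi]
    set τ := ρ / 4 ^ s.card with hτ
    have hτ0 : 0 < τ := by positivity
    have hτ' : ρ / 4 ^ (s.card + 1) = τ / 4 := by rw [hτ, pow_succ]; field_simp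
    rw [hτ']
    have hui := hu i (Finset.mem_insert_self i s)
    obtain ⟨k, hk, hki⟩ : ∃ k : ℝ, |k| = τ / 2 ∧ τ / 2 ≤ |inner ℝ (u i) q - t i + k| := by
      rcases le_total 0 (inner ℝ (u i) q - t i) with h | h
      · exact ⟨τ / 2, abs_of_pos (by positivity), (by linarith : τ / 2 ≤ _).trans (le_abs_self _)⟩
      · refine ⟨-(τ / 2), by rw [abs_neg, abs_of_pos (by positivity)], ?_⟩
        exact (by linarith : τ / 2 ≤ -(inner ℝ (u i) q - t i + -(τ / 2))).trans (neg_le_abs _)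
    have hnorm : ‖k • u i‖ = τ / 2 := by rw [norm_smul, hui, mul_one, Real.norm_eq_abs, hk]
    refine ⟨q + k • u i, ?_, fun j hj => ?_⟩
    · have : dist (q + k • u i) q = τ / 2 := by rw [dist_eq_norm, add_sub_cancel_left, hnorm]
      linarith [dist_triangle (q + k • u i) q p]
    · rw [inner_add_right]
      rcases Finset.mem_insert.1 hj with rfl | hj
      · rw [real_inner_smul_right, real_inner_self_eq_norm_sq, hui]
        have : inner ℝ (u j) q + k * 1 ^ 2 - t j = inner ℝ (u j) q - t j + k := by ring
        rw [this]
        linarith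
      · have h1 := abs_real_inner_le_norm (u j) (k • u i)
        rw [hu j (Finset.mem_insert_of_mem hj), hnorm, one_mul] at h1
        have h2 := hqs j hj
        have h3 := abs_sub_abs_le_abs_sub (inner ℝ (u j) q - t j) (-inner ℝ (u j) (k • u i))
        rw [abs_neg, sub_neg_eq_add, sub_add_eq_add_sub] at h3
        linarith

/-- Fewer than `d + 1` points lie on a hyperplane. -/
theorem exists_hyperplane {T : Finset (Euc d)} (hT : T.card ≤ d) (hd : 1 ≤ d) :
    ∃ (u : Euc d) (t : ℝ), ‖u‖ = 1 ∧ ∀ x ∈ T, inner ℝ u x = t := by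
  classical
  have hlt : Module.finrank ℝ (vectorSpan ℝ (T : Set (Euc d))) < d := by
    rcases T.eq_empty_or_nonempty with rfl | hne
    · rw [Finset.coe_empty, vectorSpan_empty, finrank_bot]; exact hd
    have hpos : 0 < T.card := Finset.card_pos.2 hne
    have hle := finrank_vectorSpan_range_le ℝ (fun y : T => (y : Euc d)) (n := T.card - 1)
      (by rw [Fintype.card_coe]; omega)
    have hr : Set.range (fun y : T => (y : Euc d)) = T := Subtype.range_coe
    rw [hr] at hle
    omega
  have hne : (vectorSpan ℝ (T : Set (Euc d)))ᗮ ≠ ⊥ := fun h => by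
    rw [Submodule.orthogonal_eq_bot_iff] at h
    rw [h, finrank_top, finrank_euclideanSpace_fin] at hlt
    exact lt_irrefl _ hlt
  obtain ⟨v, hv, hv0⟩ := Submodule.exists_mem_ne_zero_of_ne_bot hne
  rcases T.eq_empty_or_nonempty with rfl | ⟨y, hy⟩
  · exact ⟨‖v‖⁻¹ • v, 0, norm_smul_inv_norm hv0, by simp⟩
  · refine ⟨‖v‖⁻¹ • v, inner ℝ (‖v‖⁻¹ • v) y, norm_smul_inv_norm hv0, fun x hx => ?_⟩
    rw [← sub_eq_zero, ← inner_sub_right, real_inner_smul_left, real_inner_comm]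
    exact mul_eq_zero_of_right _
      ((Submodule.mem_orthogonal _ _).1 hv _ (vsub_mem_vectorSpan ℝ hx hy))

/-- A point can be moved by at most `ρ` to a position at distance at least `η` from a hyperplane
through any at most `d` nearby points of `A`. -/
theorem exists_perturbation (hd : 1 ≤ d) {σ ρ : ℝ} (hσ : 0 < σ) (hρ : 0 < ρ) (K : ℝ) :
    ∃ η, 0 < η ∧ ∀ A : Set (Euc d), (∀ x ∈ A, ∀ y ∈ A, x ≠ y → σ ≤ dist x y) → ∀ p,
      ∃ q, dist q p ≤ ρ ∧ ∀ T : Finset (Euc d), (T : Set (Euc d)) ⊆ A → T.card ≤ d →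
        (∀ x ∈ T, dist q x ≤ K) → ∃ (u : Euc d) (t : ℝ), ‖u‖ = 1 ∧ (∀ x ∈ T, inner ℝ u x = t) ∧
          η ≤ |inner ℝ u q - t| := by
  classical
  obtain ⟨N, hN⟩ := exists_packing_bound d hσ (K + ρ)
  -- At most `N` points are relevant, hence at most `2 ^ N` subsets and hyperplanes.
  refine ⟨ρ / 4 ^ 2 ^ N, by positivity, fun A hA p => ?_⟩
  obtain ⟨hfin, hcard⟩ := hN A hA p
  obtain ⟨F, hF⟩ := hfin.exists_finset_coe
  rw [← hF, Set.ncard_coe_finset] at hcard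
  have hut : ∀ T : Finset (Euc d), ∃ (u : Euc d) (t : ℝ), T.card ≤ d →
      ‖u‖ = 1 ∧ ∀ x ∈ T, inner ℝ u x = t := fun T => by
    by_cases hT : T.card ≤ d
    · obtain ⟨u, t, h⟩ := exists_hyperplane hT hd
      exact ⟨u, t, fun _ => h⟩
    · exact ⟨0, 0, fun h => absurd h hT⟩
  choose u t hut using hut
  obtain ⟨q, hqp, hq⟩ := exists_avoiding_hyperplanes (F.powerset.filter fun T => T.card ≤ d) u t
    (fun T hT => (hut T (Finset.mem_filter.1 hT).2).1) p hρ
  set n := (F.powerset.filter fun T => T.card ≤ d).card with hn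
  have hn2 : n ≤ 2 ^ N := (Finset.card_filter_le _ _).trans (by
    rw [Finset.card_powerset]; exact Nat.pow_le_pow_right (by norm_num) hcard)
  have hle : ρ / 4 ^ 2 ^ N ≤ ρ / 4 ^ n :=
    div_le_div_of_nonneg_left hρ.le (by positivity) (pow_le_pow_right₀ (by norm_num) hn2)
  have hpos : 0 < ρ / 4 ^ n := by positivity
  refine ⟨q, by linarith, fun T hTA hTd hTK => ?_⟩
  have hTF : T ∈ F.powerset.filter fun T => T.card ≤ d := by
    refine Finset.mem_filter.2 ⟨Finset.mem_powerset.2 ?_, hTd⟩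
    rw [← Finset.coe_subset, hF]
    refine fun x hx => ⟨hTA hx, ?_⟩
    rw [Metric.mem_closedBall]
    linarith [dist_triangle x q p, hTK x hx, dist_comm x q]
  exact ⟨u T, t T, (hut T hTd).1, (hut T hTd).2, hle.trans (hq T hTF)⟩

end Perturb

/-! ### Point sets with uniformly thick simplices -/

section Lattice

variable {d : ℕ}

theorem sub_mem_intLattice {x y : Euc d} (hx : x ∈ intLattice d) (hy : y ∈ intLattice d) :
    x - y ∈ intLattice d := fun i => by
  obtain ⟨m, hm⟩ := hx i
  obtain ⟨n, hn⟩ := hy i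
  exact ⟨m - n, by rw [PiLp.sub_apply, hm, hn]; push_cast; rfl⟩

theorem one_le_abs_intCast_sub {m n : ℤ} (h : (m : ℝ) ≠ n) : 1 ≤ |(m : ℝ) - n| := by
  have h1 : 1 ≤ |m - n| := Int.one_le_abs fun e => h (by rw [sub_eq_zero.1 e])
  have h2 : ((1 : ℤ) : ℝ) ≤ ((|m - n| : ℤ) : ℝ) := Int.cast_le.2 h1
  rwa [Int.cast_abs, Int.cast_sub, Int.cast_one] at h2

theorem abs_sub_apply_le_dist (x y : Euc d) (i : Fin d) : |x i - y i| ≤ dist x y := by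
  rw [dist_eq_norm, ← Real.norm_eq_abs, ← PiLp.sub_apply]
  exact PiLp.norm_apply_le _ i

theorem one_le_dist_of_mem_intLattice {x y : Euc d} (hx : x ∈ intLattice d)
    (hy : y ∈ intLattice d) (hxy : x ≠ y) : 1 ≤ dist x y := by
  obtain ⟨i, hi⟩ : ∃ i, x i ≠ y i := by
    by_contra! h
    exact hxy (by ext i; exact h i)
  obtain ⟨m, hm⟩ := hx i
  obtain ⟨n, hn⟩ := hy i
  refine le_trans ?_ (abs_sub_apply_le_dist x y i)
  rw [hm, hn] at hi ⊢
  exact one_le_abs_intCast_sub hi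

theorem exists_intLattice_dist_le (x : Euc d) :
    ∃ n ∈ intLattice d, dist x n ≤ √d / 2 := by
  refine ⟨WithLp.toLp 2 fun i => (round (x i) : ℝ), fun i => ⟨round (x i), rfl⟩, ?_⟩
  rw [EuclideanSpace.dist_eq]
  have h : ∀ i, dist (x i) ((round (x i) : ℤ) : ℝ) ^ 2
      ≤ (1 / 2) ^ 2 := fun i => by
    have := abs_sub_round (x i)
    rw [Real.dist_eq]
    gcongr
  refine (Real.sqrt_le_sqrt (Finset.sum_le_sum fun i _ => h i)).trans (le_of_eq ?_)
  rw [Finset.sum_const, Finset.card_univ, Fintype.card_fin, nsmul_eq_mul,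
    Real.sqrt_mul (Nat.cast_nonneg d), Real.sqrt_sq (by norm_num)]
  ring

/-- Up to isometry there are finitely many simplices of bounded diameter with vertices in the
integer lattice. -/
theorem exists_intLattice_thick (d : ℕ) (K : ℝ) :
    ∃ c, 0 < c ∧ ∀ (φ : Euc d →ᵃⁱ[ℝ] Euc d) (T : Finset (Euc d)),
      (T : Set (Euc d)) ⊆ φ '' intLattice d → AffineIndependent ℝ ((↑) : T → Euc d) →
      (∀ x ∈ T, ∀ y ∈ T, dist x y ≤ K) → Thick c T := by
  classical
  obtain ⟨N, hN⟩ := exists_packing_bound d one_pos K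
  obtain ⟨F, hF⟩ := (hN (intLattice d)
    (fun x hx y hy => one_le_dist_of_mem_intLattice hx hy) 0).1.exists_finset_coe
  have hc : ∀ S : Finset (Euc d), ∃ c, 0 < c ∧
      (AffineIndependent ℝ ((↑) : S → Euc d) → Thick c S) := fun S => by
    by_cases hS : AffineIndependent ℝ ((↑) : S → Euc d)
    · obtain ⟨c, hc, h⟩ := exists_thick hS
      exact ⟨c, hc, fun _ => h⟩
    · exact ⟨1, one_pos, fun h => absurd h hS⟩
  choose c hc0 hc using hc
  obtain ⟨S₀, -, hmin⟩ := Finset.exists_min_image F.powerset c ⟨∅, Finset.empty_mem_powerset F⟩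
  refine ⟨c S₀, hc0 S₀, fun φ T hT hTi hTK => ?_⟩
  rcases T.eq_empty_or_nonempty with rfl | ⟨t, ht⟩
  · exact fun w _ x hx => absurd hx (Finset.notMem_empty x)
  obtain ⟨n, hn, rfl⟩ := hT ht
  let ψ : Euc d →ᵃⁱ[ℝ] Euc d := φ.comp (AffineIsometryEquiv.constVAdd ℝ (Euc d) n).toAffineIsometry
  have hψ : ∀ z, ψ z = φ (n + z) := fun z => rfl
  let S : Finset (Euc d) := T.preimage ψ ψ.injective.injOn
  have hmem : ∀ z, z ∈ S ↔ φ (n + z) ∈ T := fun z => Finset.mem_preimage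
  have hTS : (T : Set (Euc d)) = ψ '' S := by
    ext x
    refine ⟨fun hx => ?_, ?_⟩
    · obtain ⟨m, hm, rfl⟩ := hT hx
      refine ⟨m - n, (hmem _).2 ?_, ?_⟩
      · rwa [add_sub_cancel]
      · rw [hψ, add_sub_cancel]
    · rintro ⟨z, hz, rfl⟩
      exact (hmem z).1 hz
  have hSF : S ∈ F.powerset := by
    rw [Finset.mem_powerset, ← Finset.coe_subset, hF]
    intro z hz
    have hz' := (hmem z).1 hz
    obtain ⟨m, hm, hmz⟩ := hT hz'
    have e : z = m - n := by rw [φ.injective hmz, add_sub_cancel_left]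
    refine ⟨e ▸ sub_mem_intLattice hm hn, ?_⟩
    have := hTK _ hz' _ ht
    rwa [φ.dist_map, dist_self_add_left, ← dist_zero_right] at this
  have hSi : AffineIndependent ℝ ((↑) : S → Euc d) := by
    rw [← AffineMap.affineIndependent_iff (f := ψ.toAffineMap) ψ.injective]
    exact hTi.comp_embedding ⟨fun z : S => (⟨ψ z, (hmem z).1 z.2⟩ : T), fun z z' h =>
      Subtype.ext (ψ.injective (congrArg Subtype.val h))⟩
  exact ((hc S hSi).mono (hmin S hSF)).image_affineIsometry ψ hTS

end Lattice

section Family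

variable {d : ℕ}

/-- Perturbing the points `p i` one after the other, each one away from the hyperplanes spanned
by nearby points of `L` and nearby points already placed. -/
theorem exists_perturbed_family {ι : Type*} [LinearOrder ι] [WellFoundedLT ι] {σ ρ η K : ℝ}
    (hη : ∀ A : Set (Euc d), (∀ x ∈ A, ∀ y ∈ A, x ≠ y → σ ≤ dist x y) → ∀ p,
      ∃ q, dist q p ≤ ρ ∧ ∀ T : Finset (Euc d), (T : Set (Euc d)) ⊆ A → T.card ≤ d →
        (∀ x ∈ T, dist q x ≤ K) → ∃ (u : Euc d) (t : ℝ), ‖u‖ = 1 ∧ (∀ x ∈ T, inner ℝ u x = t) ∧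
          η ≤ |inner ℝ u q - t|) (hρ : 0 ≤ ρ) (L : Set (Euc d)) (p : ι → Euc d)
    (hsep : ∀ g : ι → Euc d, (∀ i, dist (g i) (p i) ≤ ρ) →
      ∀ x ∈ L ∪ Set.range g, ∀ y ∈ L ∪ Set.range g, x ≠ y → σ ≤ dist x y) :
    ∃ f : ι → Euc d, (∀ i, dist (f i) (p i) ≤ ρ) ∧ ∀ i, ∀ T : Finset (Euc d),
      (T : Set (Euc d)) ⊆ L ∪ f '' Set.Iio i → T.card ≤ d → (∀ x ∈ T, dist (f i) x ≤ K) →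
        ∃ (u : Euc d) (t : ℝ), ‖u‖ = 1 ∧ (∀ x ∈ T, inner ℝ u x = t) ∧
          η ≤ |inner ℝ u (f i) - t| := by
  classical
  have step : ∀ i (g : ∀ j, j < i → Metric.closedBall (p j) ρ),
      ∃ q : Metric.closedBall (p i) ρ, ∀ T : Finset (Euc d),
        (T : Set (Euc d)) ⊆ L ∪ {x | ∃ j, ∃ h : j < i, (g j h : Euc d) = x} → T.card ≤ d →
        (∀ x ∈ T, dist (q : Euc d) x ≤ K) →
          ∃ (u : Euc d) (t : ℝ), ‖u‖ = 1 ∧ (∀ x ∈ T, inner ℝ u x = t) ∧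
            η ≤ |inner ℝ u (q : Euc d) - t| := by
    intro i g
    let g' : ι → Euc d := fun j => if h : j < i then (g j h : Euc d) else p j
    have hg' : ∀ j, dist (g' j) (p j) ≤ ρ := fun j => by
      by_cases h : j < i
      · simp only [g', dif_pos h]
        exact (g j h).2
      · simp only [g', dif_neg h, dist_self]
        exact hρ
    have hsub : L ∪ {x | ∃ j, ∃ h : j < i, (g j h : Euc d) = x} ⊆ L ∪ Set.range g' := by
      refine Set.union_subset_union_right _ ?_
      rintro x ⟨j, h, rfl⟩
      exact ⟨j, by simp only [g', dif_pos h]⟩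
    obtain ⟨q, hq, hqT⟩ := hη _ (fun x hx y hy => hsep g' hg' x (hsub hx) y (hsub hy)) (p i)
    exact ⟨⟨q, hq⟩, hqT⟩
  choose F hF using step
  let f : ∀ i, Metric.closedBall (p i) ρ := wellFounded_lt.fix F
  have hf : ∀ i, f i = F i fun j _ => f j := fun i => wellFounded_lt.fix_eq F i
  refine ⟨fun i => f i, fun i => (f i).2, fun i T hT hTd hTK => ?_⟩
  have := hF i (fun j _ => f j) T (hT.trans (Set.union_subset_union_right _ ?_)) hTd
    (by rw [← hf]; exact hTK)
  · rwa [← hf] at this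
  · rintro x ⟨j, hj, rfl⟩
    exact ⟨j, hj, rfl⟩

/-- Completion of a locally lattice-like set `L` to a relatively dense separated set whose
nondegenerate simplices of bounded diameter are uniformly thick. -/
theorem exists_thick_point_set (hd : 1 ≤ d) {s K : ℝ} (hs : 0 < s) (hK : 0 ≤ K) :
    ∃ c, 0 < c ∧ ∀ L : Set (Euc d), (∀ x ∈ L, ∀ y ∈ L, x ≠ y → 1 ≤ dist x y) →
      (∀ T : Finset (Euc d), (T : Set (Euc d)) ⊆ L → (∀ x ∈ T, ∀ y ∈ T, dist x y ≤ K) →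
        ∃ φ : Euc d →ᵃⁱ[ℝ] Euc d, (T : Set (Euc d)) ⊆ φ '' intLattice d) →
      ∃ V : Set (Euc d), L ⊆ V ∧ (∀ x ∈ V, x ∉ L → ∀ y ∈ L, 3 * s / 4 ≤ dist x y) ∧
        (∀ x ∈ V, ∀ y ∈ V, x ≠ y → min 1 (s / 2) ≤ dist x y) ∧
        (∀ q, ∃ v ∈ V, dist v q < 2 * s) ∧
        ∀ S : Finset (Euc d), (S : Set (Euc d)) ⊆ V → AffineIndependent ℝ ((↑) : S → Euc d) →
          S.card ≤ d + 1 → (∀ x ∈ S, ∀ y ∈ S, dist x y ≤ K) → Thick c S := by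
  classical
  have hσ : 0 < min 1 (s / 2) := lt_min one_pos (by positivity)
  obtain ⟨η, hη0, hη⟩ := exists_perturbation hd hσ (by positivity : 0 < s / 4) K
  obtain ⟨c₀, hc₀, hlat⟩ := exists_intLattice_thick d K
  obtain ⟨c, hc, hthick⟩ := exists_thick_of_steps (d := d) hc₀ hη0 hK (d + 1)
  refine ⟨c, hc, fun L hL hLφ => ?_⟩
  obtain ⟨P, hP, hPL, hPd⟩ := exists_maximal_separated L hs
  obtain ⟨_, _⟩ := exists_wellFoundedLT (α := ULift.{0} P)
  let p : ULift.{0} P → Euc d := fun i => i.down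
  have hpP : ∀ i, p i ∈ P := fun i => i.down.2
  have hpinj : ∀ i j, i ≠ j → s ≤ dist (p i) (p j) := fun i j hij =>
    hP _ (hpP i) _ (hpP j) fun h => hij (ULift.down_injective (Subtype.ext h))
  have hgg : ∀ g : ULift.{0} P → Euc d, (∀ i, dist (g i) (p i) ≤ s / 4) → ∀ i j, i ≠ j →
      s / 2 ≤ dist (g i) (g j) := fun g hg i j hij => by
    have h1 := hpinj i j hij
    have h2 := dist_triangle4 (p i) (g i) (g j) (p j)
    linarith [hg i, hg j, dist_comm (p i) (g i)]
  have hgL : ∀ g : ULift.{0} P → Euc d, (∀ i, dist (g i) (p i) ≤ s / 4) → ∀ i, ∀ y ∈ L,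
      3 * s / 4 ≤ dist (g i) y := fun g hg i y hy => by
    have h1 := hPL _ (hpP i) y hy
    have h2 := dist_triangle (p i) (g i) y
    linarith [hg i, dist_comm (p i) (g i)]
  have hsep : ∀ g : ULift.{0} P → Euc d, (∀ i, dist (g i) (p i) ≤ s / 4) →
      ∀ x ∈ L ∪ Set.range g, ∀ y ∈ L ∪ Set.range g, x ≠ y → min 1 (s / 2) ≤ dist x y := by
    rintro g hg x (hx | ⟨i, rfl⟩) y (hy | ⟨j, rfl⟩) hxy
    · exact (min_le_left _ _).trans (hL x hx y hy hxy)
    · rw [dist_comm]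
      exact (min_le_right _ _).trans ((by linarith : s / 2 ≤ 3 * s / 4).trans (hgL g hg j x hx))
    · exact (min_le_right _ _).trans ((by linarith : s / 2 ≤ 3 * s / 4).trans (hgL g hg i y hy))
    · exact (min_le_right _ _).trans (hgg g hg i j fun h => hxy (by rw [h]))
  obtain ⟨f, hf, hfT⟩ := exists_perturbed_family hη (by positivity) L p hsep
  have hfinj : Function.Injective f := fun i j hij => by
    by_contra hne
    have := hgg f hf i j hne
    rw [hij, dist_self] at this
    linarith
  refine ⟨L ∪ Set.range f, Set.subset_union_left, ?_, hsep f hf, fun q => ?_, ?_⟩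
  · rintro x (hx | ⟨i, rfl⟩) hxL y hy
    · exact absurd hx hxL
    · exact hgL f hf i y hy
  · obtain ⟨y, hy | hy, hyq⟩ := hPd q
    · exact ⟨y, Or.inl hy, by linarith⟩
    · refine ⟨f ⟨⟨y, hy⟩⟩, Or.inr ⟨_, rfl⟩, ?_⟩
      have h1 : dist (f ⟨⟨y, hy⟩⟩) y ≤ s / 4 := hf ⟨⟨y, hy⟩⟩
      linarith [dist_triangle (f ⟨⟨y, hy⟩⟩) y q]
  intro S hSV hSi hSc hSK
  refine hthick {S | (S : Set (Euc d)) ⊆ L ∪ Set.range f ∧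
    AffineIndependent ℝ ((↑) : S → Euc d) ∧ S.card ≤ d + 1 ∧ ∀ x ∈ S, ∀ y ∈ S, dist x y ≤ K}
    ?_ S ⟨hSV, hSi, hSc, hSK⟩ hSc
  clear hSV hSi hSc hSK S
  rintro S ⟨hSV, hSi, hSc, hSK⟩
  by_cases hSL : (S : Set (Euc d)) ⊆ L
  · obtain ⟨φ, hφ⟩ := hLφ S hSL hSK
    exact Or.inl (hlat φ S hφ hSi hSK)
  -- Otherwise remove the vertex of `S` that was placed last.
  right
  let I : Finset (ULift.{0} P) := S.preimage f hfinj.injOn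
  have hI : I.Nonempty := by
    obtain ⟨x, hx, hxL⟩ := Set.not_subset.1 hSL
    obtain ⟨i, rfl⟩ := (hSV hx).resolve_left hxL
    exact ⟨i, Finset.mem_preimage.2 hx⟩
  obtain ⟨i, hi, hmax⟩ := Finset.exists_max_image I id hI
  have hiS : f i ∈ S := Finset.mem_preimage.1 hi
  have hsub : S.erase (f i) ⊆ S := Finset.erase_subset _ _
  have hcard : (S.erase (f i)).card ≤ d := by
    rw [Finset.card_erase_of_mem hiS]; omega
  have hprev : ((S.erase (f i) : Finset (Euc d)) : Set (Euc d)) ⊆ L ∪ f '' Set.Iio i := by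
    intro x hx
    obtain ⟨hxi, hxS⟩ := Finset.mem_erase.1 hx
    rcases hSV hxS with hxL | ⟨j, rfl⟩
    · exact Or.inl hxL
    · exact Or.inr ⟨j, lt_of_le_of_ne (hmax j (Finset.mem_preimage.2 hxS)) fun h =>
        hxi (by rw [h]), rfl⟩
  obtain ⟨u, t, hu, hut, hη'⟩ := hfT i _ hprev hcard fun x hx => hSK _ hiS x (hsub hx)
  refine ⟨f i, u, S.erase (f i), ⟨(Finset.coe_subset.2 hsub).trans hSV, ?_,
    hcard.trans (Nat.le_succ d), fun x hx y hy => hSK x (hsub hx) y (hsub hy)⟩, t,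
    Finset.notMem_erase _ _, ?_, fun x hx => hSK _ hiS x (hsub hx), hu, hut, hη'⟩
  · exact hSi.mono (Finset.coe_subset.2 hsub)
  · rw [← Finset.coe_insert, Finset.insert_erase hiS]

end Family

/-! ### Rotated lattices in separated cubes -/

section Grains

variable {d : ℕ}

theorem exists_linearIsometryEquiv_of_specialOrthogonal
    (A : Matrix.specialOrthogonalGroup (Fin d) ℝ) :
    ∃ ψ : Euc d ≃ₗᵢ[ℝ] Euc d, ∀ x,
      ψ x = Matrix.toEuclideanLin (A : Matrix (Fin d) (Fin d) ℝ) x := by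
  have hA : (A : Matrix (Fin d) (Fin d) ℝ).transpose * (A : Matrix (Fin d) (Fin d) ℝ) = 1 := by
    have := (Matrix.mem_unitaryGroup_iff' (A := (A : Matrix (Fin d) (Fin d) ℝ))).1 A.2.1
    exact this
  let T := Matrix.toEuclideanLin (A : Matrix (Fin d) (Fin d) ℝ)
  have hT : ∀ x, ‖T x‖ = ‖x‖ := fun x => by
    have h1 : inner ℝ (T x) (T x) = inner ℝ x x := by
      rw [← LinearMap.adjoint_inner_right, ← Matrix.toEuclideanLin_conjTranspose_eq_adjoint]
      congr 1
      simp [T, Matrix.toLpLin_apply, Matrix.mulVec_mulVec, hA]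
    rw [real_inner_self_eq_norm_sq, real_inner_self_eq_norm_sq] at h1
    exact (sq_eq_sq₀ (norm_nonneg _) (norm_nonneg _)).1 h1
  exact ⟨LinearIsometry.toLinearIsometryEquiv ⟨T, hT⟩ rfl, fun x => rfl⟩

/-- Cubes of edge length `δ - g` about distinct points of `δℤ^d` are more than `g` apart. -/
theorem lt_dist_of_mem_cube {δ g : ℝ} (hδ : 0 < δ) {z z' : Euc d} (hz : z ∈ δ • intLattice d)
    (hz' : z' ∈ δ • intLattice d) (hne : z ≠ z') {x y : Euc d} (hx : x ∈ cube (δ - g) z)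
    (hy : y ∈ cube (δ - g) z') : g < dist x y := by
  obtain ⟨m, hm, rfl⟩ := hz
  obtain ⟨n, hn, rfl⟩ := hz'
  obtain ⟨i, hi⟩ : ∃ i, m i ≠ n i := by
    by_contra! h
    exact hne (by congr 1; ext i; exact h i)
  obtain ⟨a, ha⟩ := hm i
  obtain ⟨b, hb⟩ := hn i
  rw [ha, hb] at hi
  have hab := one_le_abs_intCast_sub hi
  refine lt_of_lt_of_le ?_ (abs_sub_apply_le_dist x y i)
  have hxi := hx i
  have hyi := hy i
  simp only [PiLp.smul_apply, smul_eq_mul, ha, hb, Set.mem_Ioo] at hxi hyi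
  rcases le_abs.1 hab with h | h
  · refine lt_of_lt_of_le ?_ (le_abs_self _)
    nlinarith [hxi.1, hyi.2]
  · refine lt_of_lt_of_le ?_ (neg_le_abs _)
    nlinarith [hxi.2, hyi.1]

theorem mem_cube_of_dist_le {l l' ρ : ℝ} {x y z : Euc d} (hx : x ∈ cube l z)
    (hxy : dist x y ≤ ρ) (hl : l + 2 * ρ ≤ l') : y ∈ cube l' z := fun i => by
  have h1 := hx i
  have h2 := abs_le.1 ((abs_sub_apply_le_dist x y i).trans hxy)
  rw [Set.mem_Ioo] at h1 ⊢
  constructor <;> linarith [h1.1, h1.2, h2.1, h2.2]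

end Grains

/-! ### Volume and diameter of thick simplices -/

section Volume

variable {d : ℕ}

/-- Thickness bounds the diameter by the volume; `β` is the volume of the unit ball. -/
theorem Thick.diam_pow_le {c K β : ℝ} {S : Finset (Euc d)} (hc0 : 0 < c) (hK : 0 ≤ K)
    (hS : Thick c S) (hi : AffineIndependent ℝ ((↑) : S → Euc d)) (hc : S.card = d + 1)
    (hSK : ∀ x ∈ S, ∀ y ∈ S, dist x y ≤ K)
    (hβ : β = (MeasureTheory.volume (Metric.ball (0 : Euc d) 1)).toReal) :
    Metric.diam (convexHull ℝ (S : Set (Euc d))) ^ d ≤ (K * (d + 1) / c) ^ d / β *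
      (MeasureTheory.volume (convexHull ℝ (S : Set (Euc d)))).toReal := by
  have hβ0 : 0 < β := by
    rw [hβ]
    exact ENNReal.toReal_pos (Metric.measure_ball_pos _ _ one_pos).ne'
      MeasureTheory.measure_ball_lt_top.ne
  obtain ⟨x, hx⟩ := hS.exists_closedBall_subset hc0 hi hc
  have hvol : (c / (d + 1)) ^ d * β ≤
      (MeasureTheory.volume (convexHull ℝ (S : Set (Euc d)))).toReal := by
    have h1 := MeasureTheory.measure_mono (μ := MeasureTheory.volume) hx
    have h2 := ENNReal.toReal_mono (S.finite_toSet.isCompact_convexHull ℝ).measure_lt_top.ne h1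
    rwa [MeasureTheory.Measure.addHaar_closedBall _ _ (by positivity), ENNReal.toReal_mul,
      ENNReal.toReal_ofReal (by positivity), finrank_euclideanSpace_fin, ← hβ] at h2
  have hdiam : Metric.diam (convexHull ℝ (S : Set (Euc d))) ≤ K := by
    rw [convexHull_diam]
    exact Metric.diam_le_of_forall_dist_le hK hSK
  calc Metric.diam (convexHull ℝ (S : Set (Euc d))) ^ d ≤ K ^ d :=
        pow_le_pow_left₀ Metric.diam_nonneg hdiam d
    _ = (K * (d + 1) / c) ^ d / β * ((c / (d + 1)) ^ d * β) := by
        have : K = K * (d + 1) / c * (c / (d + 1)) := by field_simp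
        conv_lhs => rw [this, mul_pow]
        field_simp
    _ ≤ _ := by gcongr

end Volume

end Delaunay

open Delaunay

/-! ### The grain construction -/

theorem theorem2p11 (d : ℕ) (hd : 2 ≤ d) :
    ∃ C : ℝ, 0 < C ∧
      ∀ (ε δ : ℝ), 0 < ε → ε < δ → C * ε ≤ δ →
      ∀ R : ↥(δ • intLattice d) → Matrix.specialOrthogonalGroup (Fin d) ℝ,
      ∃ (V : Set (Euc d)) (E : Set (Set (Euc d))),
        IsTriangulation V E ∧
        IsDelaunay V E ∧
        IsNondegenerate E C ∧
        IsUniform V C ε ∧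
        ∀ z : ↥(δ • intLattice d),
          V ∩ cube (δ - C * ε) (z : Euc d) =
            (ε • (Matrix.toEuclideanLin (R z : Matrix (Fin d) (Fin d) ℝ) '' intLattice d)) ∩
              cube (δ - C * ε) (z : Euc d) := by
  classical
  have hd1 : 1 ≤ d := by omega
  -- With `s = √d`, added points keep distance `3 * s / 4` from the grains, more than the covering
  -- radius `s / 2` of the integer lattice; simplices will have edges of length at most `4 * s`.
  set s := √(d : ℝ) with hs_def
  have hs1 : 1 ≤ s := Real.one_le_sqrt.2 (by exact_mod_cast hd1)
  have hs : 0 < s := by linarith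
  obtain ⟨c, hc, hmain⟩ := exists_thick_point_set hd1 hs (by positivity : 0 ≤ 4 * s)
  -- The separation of the rescaled point set.
  set m := min 1 (s / 2) with hm_def
  have hm : 0 < m := lt_min one_pos (by positivity)
  set β := (MeasureTheory.volume (Metric.ball (0 : Euc d) 1)).toReal with hβ
  set D := (4 * s * (d + 1) / c) ^ d / β with hD_def
  have hD : 0 ≤ D := by positivity
  have hm' : 0 < 1 / m := by positivity
  -- `5 * s` is the gap between grains, `2 * s` the density radius and the margin in the orientation
  -- property, `1 / m` the separation and `D` the nondegeneracy constant.
  refine ⟨7 * s + 1 / m + D, by positivity, fun ε δ hε hεδ hC R => ?_⟩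
  set C := 7 * s + 1 / m + D with hC_def
  have hCs : 7 * s ≤ C := by linarith
  have hδ : 0 < δ := hε.trans hεδ
  choose ψ hψ using fun z => exists_linearIsometryEquiv_of_specialOrthogonal (R z)
  -- The lattice points of all grains, rescaled to lattice spacing one.
  let L : Set (Euc d) := {x | ∃ z : ↥(δ • intLattice d),
    x ∈ ψ z '' intLattice d ∧ ε • x ∈ cube (δ - 5 * s * ε) (z : Euc d)}
  -- Different grains are further apart than the edge length `4 * s` of any Delaunay simplex.
  have hgap : ∀ z z' : ↥(δ • intLattice d), ∀ x y : Euc d,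
      ε • x ∈ cube (δ - 5 * s * ε) (z : Euc d) → ε • y ∈ cube (δ - 5 * s * ε) (z' : Euc d) →
      dist x y ≤ 5 * s → z = z' := fun z z' x y hx hy hxy => by
    by_contra hne
    have h1 := lt_dist_of_mem_cube hδ z.2 z'.2 (fun h => hne (Subtype.ext h)) hx hy
    rw [dist_smul₀, Real.norm_of_nonneg hε.le] at h1
    nlinarith
  obtain ⟨V, hLV, hVL, hVsep, hVd, hVthick⟩ := hmain L (by
    rintro x ⟨z, ⟨a, ha, rfl⟩, hx⟩ y ⟨z', ⟨b, hb, rfl⟩, hy⟩ hxy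
    by_contra hlt
    obtain rfl := hgap z z' _ _ hx hy (by linarith)
    rw [(ψ z).dist_map] at hlt
    exact hlt (one_le_dist_of_mem_intLattice ha hb fun h => hxy (by rw [h]))) (by
    intro T hT hTK
    rcases T.eq_empty_or_nonempty with rfl | ⟨t, ht⟩
    · exact ⟨AffineIsometry.id, by simp⟩
    · obtain ⟨z, -, htz⟩ := hT ht
      refine ⟨(ψ z).toLinearIsometry.toAffineIsometry, fun x hx => ?_⟩
      obtain ⟨z', hx1, hx2⟩ := hT hx
      obtain rfl := hgap z' z x t hx2 htz ((hTK x hx t ht).trans (by linarith))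
      exact hx1)
  have hVε : ∀ x, x ∈ ε • V ↔ ε⁻¹ • x ∈ V := fun x => Set.mem_smul_set_iff_inv_smul_mem₀ hε.ne' V x
  have hsepε : ∀ x ∈ ε • V, ∀ y ∈ ε • V, x ≠ y → ε * m ≤ dist x y := by
    rintro _ ⟨x, hx, rfl⟩ _ ⟨y, hy, rfl⟩ hxy
    simp only at hxy ⊢
    rw [dist_smul₀, Real.norm_of_nonneg hε.le]
    exact mul_le_mul_of_nonneg_left (hVsep x hx y hy fun h => hxy (by rw [h])) hε.le
  have hdense : ∀ q, (Metric.ball q (2 * s * ε) ∩ ε • V).Nonempty := fun q => by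
    obtain ⟨v, hv, hvq⟩ := hVd (ε⁻¹ • q)
    refine ⟨ε • v, ?_, Set.smul_mem_smul_set hv⟩
    have : q = ε • ε⁻¹ • q := (smul_inv_smul₀ hε.ne' q).symm
    rw [Metric.mem_ball, this, dist_smul₀, Real.norm_of_nonneg hε.le, mul_comm (2 * s) ε]
    exact mul_lt_mul_of_pos_left hvq hε
  obtain ⟨E, hE, hEdel, hES⟩ := exists_delaunay_triangulation hd1 (by positivity) hdense
    (countable_of_separated (by positivity) hsepε) fun x r => by
      obtain ⟨N, hN⟩ := exists_packing_bound d (by positivity : 0 < ε * m) r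
      exact (hN _ hsepε x).1
  refine ⟨ε • V, E, hE, hEdel, ⟨by positivity, fun e he => ?_⟩, ⟨by positivity, hε, ?_, ?_⟩, ?_⟩
  · obtain ⟨S, rfl, hSV, hSc, hSi, hSK⟩ := hES e he
    have hSK' : ∀ x ∈ S, ∀ y ∈ S, dist x y ≤ ε * (4 * s) := fun x hx y hy =>
      (hSK x hx y hy).trans (by linarith)
    let S' : Finset (Euc d) := S.image (ε⁻¹ • ·)
    have hinj : Function.Injective fun x : Euc d => ε⁻¹ • x :=
      smul_right_injective _ (inv_ne_zero hε.ne')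
    have hSS' : (S : Set (Euc d)) = ε • (S' : Set (Euc d)) := by
      rw [Finset.coe_image]
      change _ = ε • (ε⁻¹ • (S : Set (Euc d)))
      rw [smul_inv_smul₀ hε.ne']
    have hS'i : AffineIndependent ℝ ((↑) : S' → Euc d) := by
      have hlin : Function.Injective (LinearMap.lsmul ℝ (Euc d) ε).toAffineMap :=
        smul_right_injective _ hε.ne'
      rw [← AffineMap.affineIndependent_iff (f := (LinearMap.lsmul ℝ (Euc d) ε).toAffineMap) hlin]
      refine hSi.comp_embedding ⟨fun z : S' => (⟨ε • (z : Euc d), ?_⟩ : S), fun z z' h =>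
        Subtype.ext (hlin (congrArg Subtype.val h))⟩
      rw [← Finset.mem_coe, hSS']
      exact Set.smul_mem_smul_set z.2
    have hthick : Thick c S' := by
      refine hVthick S' ?_ hS'i ?_ ?_
      · intro x hx
        obtain ⟨y, hy, rfl⟩ := Finset.mem_image.1 hx
        exact (hVε y).1 (hSV hy)
      · exact Finset.card_image_le.trans hSc.le
      · intro x hx y hy
        obtain ⟨x, hx', rfl⟩ := Finset.mem_image.1 hx
        obtain ⟨y, hy', rfl⟩ := Finset.mem_image.1 hy
        rw [dist_smul₀, norm_inv, Real.norm_of_nonneg hε.le, inv_mul_le_iff₀ hε]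
        exact hSK' x hx' y hy'
    have h := (hthick.smul hε hSS').diam_pow_le (by positivity) (by positivity) hSi hSc hSK' hβ
    refine h.trans (mul_le_mul_of_nonneg_right ?_ ENNReal.toReal_nonneg)
    have : ε * (4 * s) * (d + 1) / (ε * c) = 4 * s * (d + 1) / c := by field_simp
    rw [this]
    linarith
  · intro x hx y hy hxy
    refine le_trans ?_ (hsepε x hx y hy hxy)
    rw [div_le_iff₀ (by positivity)]
    have h1 : 1 ≤ m * C := by
      have : m * (1 / m) = 1 := by field_simp
      nlinarith
    nlinarith
  · intro q
    obtain ⟨v, hv, hvV⟩ := hdense q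
    exact ⟨v, Metric.ball_subset_ball (by gcongr; linarith) hv, hvV⟩
  · intro z
    have himg : Matrix.toEuclideanLin (R z : Matrix (Fin d) (Fin d) ℝ) '' intLattice d =
        ψ z '' intLattice d := Set.image_congr fun x _ => (hψ z x).symm
    rw [himg]
    have hcube : ∀ x y : Euc d, x ∈ cube (δ - C * ε) (z : Euc d) → dist x y ≤ s * ε →
        y ∈ cube (δ - 5 * s * ε) (z : Euc d) := fun x y hx hxy =>
      mem_cube_of_dist_le hx hxy (by nlinarith)
    ext x
    refine and_congr_left fun hx => ?_
    have hxx : x = ε • ε⁻¹ • x := (smul_inv_smul₀ hε.ne' x).symm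
    have hx5 : ε • ε⁻¹ • x ∈ cube (δ - 5 * s * ε) (z : Euc d) :=
      hxx ▸ hcube x x hx (by rw [dist_self]; positivity)
    rw [hVε, Set.mem_smul_set_iff_inv_smul_mem₀ hε.ne']
    refine ⟨fun hxV => ?_, fun hxψ => hLV ⟨z, hxψ, hx5⟩⟩
    by_cases hxL : ε⁻¹ • x ∈ L
    · obtain ⟨z', hxψ, hxz'⟩ := hxL
      obtain rfl := hgap z z' _ _ hx5 hxz' (by rw [dist_self]; positivity)
      exact hxψ
    -- A lattice point of the grain lies within `√d / 2`, too close for an added point.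
    · exfalso
      obtain ⟨n, hn, hxn⟩ := exists_intLattice_dist_le ((ψ z).symm (ε⁻¹ • x))
      rw [← (ψ z).dist_map, (ψ z).apply_symm_apply, ← hs_def] at hxn
      have hnL : ψ z n ∈ L := by
        refine ⟨z, ⟨n, hn, rfl⟩, hcube x _ hx ?_⟩
        rw [hxx, dist_smul₀, Real.norm_of_nonneg hε.le]
        nlinarith
      have := hVL _ hxV hxL _ hnL
      linarith
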